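/- **Setting.** Let $Z$ be a bounded doubling metric space with at least two points and with finite capacity dimension $n=\operatorname{cdim}Z$. Here, for a family $\mathcal U=\bigcup_{c\in C}\mathcal U^c$ of open sets covering $Z$, each $\mathcal U^c$ consisting of pairwise disjoint sets (an *open covering colored by $C$*), one puts $\operatorname{mesh}\mathcal U=\sup_{U\in\mathcal U}\operatorname{diam}U$ and $L(\mathcal U)=\inf_{z\in Z}\min\{\sup_{U\in\mathcal U}\operatorname{dist}(z,Z\setminus U),\operatorname{mesh}\mathcal U\}$ (with $\operatorname{dist}(z,\emptyset)=\infty$), and $\operatorname{cdim}Z$ is the least integer $m\ge 0$ for which there is $\delta>0$ such that for all sufficiently small $\tau>0$ there is an open covering $\mathcal U$ of $Z$ colored by $m+1$ colors with $\operatorname{mesh}\mathcal U\le\tau$ and $L(\mathcal U)\ge\delta\tau$. Let $C$ be a set with $|C|=n+1$. *Hyperbolic approximation.* Let $0<r\le 1/6$, and let $k_0$ be the largest integer with $\operatorname{diam}Z<r^{k_0}$. For every integer $k\ge k_0$ let $V_k\subset Z$ be a maximal $r^k$-separated set (distinct points have distance $\ge r^k$), let $V$ be the disjoint union of the $V_k$,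 and for $v\in V_k$ put $\ell(v)=k$ and let $B(v)$ be the open ball of radius $2r^k$ about $v$. The hyperbolic approximation $X$ is the graph with vertex set $V$ in which distinct vertices of the same level are adjacent iff their closed balls (of the same radii) intersect, and vertices $v\in V_k$, $v'\in V_{k+1}$ are adjacent iff $B(v')\subset B(v)$. $V$ carries the path metric of $X$. *Adapted coverings.* A sequence $\mathcal U_j$, $j\ge 0$, of open coverings of $Z$ by nonempty sets, colored by $C$, is *adapted* to $X$ if $r<\min\{\operatorname{diam}Z,1/\operatorname{diam}Z\}$ (so $k_0\in\{0,-1\}$) and (1) $\mathcal U_0^c=\{Z\}$ for all $c\in C$, and $\operatorname{mesh}\mathcal U_j<r^j$ for $j\ge1$; (2) for every $v\in V_{j+1}$, $j\ge0$, there is $U\in\mathcal U_j$ with $B(v)\subset U$; (3) for every $c\in C$ and all different members $U\in\mathcal U_j^c$, $U'\in\mathcal U_{j'}^c$ with $j'\le j$ (members with $j\neq j'$ count as different), the union $B(U)$ of all $B(v)$ with $v\in V_{j+1}$, $B(v)\cap U\ne\emptyset$ satisfies $B(U)\subset U'$ or $B(U)\cap U'=\emptyset$. *Colored trees.* The vertex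 set of the rooted tree $T_c$ is the disjoint union $\bigcup_{j\ge0}\mathcal U_j^c$. The root $Z\in\mathcal U_0^c$ has level $k_0$, and $U\in\mathcal U_j^c$, $j\ge1$, has level $\ell(U)=j$. A vertex $U'$ is an ancestor of $U$ if $\ell(U')<\ell(U)$ and $U\subset U'$, and every $U$ other than the root is joined by an edge to its ancestor of maximal level. The map $f_c:V\to T_c$ sends the vertex in $V_{k_0}$ to the root, and $v$ with $\ell(v)>k_0$ to the vertex $U$ of maximal level among those with $B(v)\subset U$ and $\ell(U)\le\ell(v)-1$. Put $f=(f_c)_{c\in C}:V\to\prod_cT_c$. *Labelling.* Let $F$ be a finite set and let $\mu_j:V_j\to F$, $j\ge k_0$, satisfy $\mu_j(v)\ne\mu_j(v')$ for distinct $v,v'\in V_j$ with $d(v,v')<2r^{j-2}$. Let $A'$ be the set of nonempty subsets of $F$, let $s$ be an additional symbol (the stop sign), and let $t(0),t(1),\dots$ be the Morse–Thue sequence. To the edge between $U$ and its ancestor $U'$ associate the word whose letters, for $k=\ell(U')+1,\dots,\ell(U)$, are $(a_k',t(k))$ with $a'_k=\{\mu_{k+1}(v): v\in V_{k+1},\ B(v)\cap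 U\neq\emptyset\}\in A'$, followed by the stop sign $(s,t(\ell(U)))$. Reading these along the path from the root to $U$ gives the decorated sentence $\alpha(U)$, whose symbols lie in $(A'\cup\{s\})\times\{0,1\}$. *Diary.* Let $\kappa\ge1$ and let $\Omega$ be the finite set of pages: a page is a word of exactly $\kappa$ symbols from $(A'\cup\{s\})\times\{0,1\}$, or a word of fewer than $\kappa$ such symbols concluded by $\star$. The diary of a sentence with $m$ words has $m$ pages, written successively. The $i$-th page lists, backward, the last $\kappa$ symbols preceding the $i$-th stop sign which are not listed on earlier pages; if fewer than $\kappa$ such symbols are left, it lists all of them and ends with $\star$. Let $T_\Omega$ be the tree of finite words in $\Omega$ (two words are adjacent iff one arises from the other by erasing the last letter), let $\psi_c:T_c\to T_\Omega$ map $U$ to the diary of $\alpha(U)$, and put $\psi=\prod_c\psi_c:\prod_cT_c\to T_\Omega^{|C|}$. The product $T_\Omega^{|C|}$ carries the $\ell_1$ product of the path metrics. **Theorem.** (a) For all sufficiently small $r>0$, hyperbolic approximations of $Z$ with parameter $r$ exist, there is a sequence of open coverings of $Z$ colored by $C$ which is adapted to every hyperbolic approximation of $Z$ with parameter $r$, and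 there is a finite set $F$ such that every hyperbolic approximation with parameter $r$ admits maps $\mu_j:V_j\to F$ as above. (b) For every hyperbolic approximation $X$ of $Z$, every sequence of open coverings colored by $C$ adapted to $X$, every finite set $F$ with maps $\mu_j$ as above, and every $\kappa\ge 15|C|+1$: $X$ is connected, $T_\Omega$ is a tree all of whose vertices have finite valence, and the composition $\psi\circ f:V\to T_\Omega^{|C|}$ is a quasi-isometric embedding, i.e. there are $a_1,a_2>0$ and $b\ge0$ with $$a_1|vv'|-b\le|\psi f(v)\,\psi f(v')|\le a_2|vv'|+b\qquad\text{for all }v,v'\in V.$$ -/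

import Mathlib

open Set
open scoped ENNReal

namespace AliceDiary

noncomputable section

/-! ### Metric notions -/

/-- Every ball can be covered by at most `N` balls of half the radius. -/
def IsDoubling (Z : Type*) [MetricSpace Z] : Prop :=
  ∃ N : ℕ, ∀ (x : Z) (ρ : ℝ), 0 < ρ →
    ∃ s : Finset Z, s.card ≤ N ∧ Metric.ball x ρ ⊆ ⋃ y ∈ s, Metric.ball y (ρ / 2)

/-- A map is quasi-isometric (a quasi-isometric embedding) with respect to the distance functions
`dX` and `dY`. -/
def IsQuasiIsometric {X Y : Type*} (dX : X → X → ℝ) (dY : Y → Y → ℝ) (f : X → Y) : Prop :=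
  ∃ a₁ a₂ b : ℝ, 0 < a₁ ∧ 0 < a₂ ∧ 0 ≤ b ∧
    ∀ x x' : X, a₁ * dX x x' - b ≤ dY (f x) (f x') ∧ dY (f x) (f x') ≤ a₂ * dX x x' + b

/-! ### Colored coverings and capacity dimension -/

/-- `𝒰 c` is the family of the members of color `c`. Each family is disjoint, all members are open,
and together they cover `Z`. The same set may occur in several colors. -/
structure IsColoredOpenCover {Z C : Type*} [MetricSpace Z] (𝒰 : C → Set (Set Z)) : Prop where
  isOpen : ∀ c, ∀ U ∈ 𝒰 c, IsOpen U
  disjoint : ∀ c, (𝒰 c).PairwiseDisjoint id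
  cover : ⋃ c, ⋃₀ 𝒰 c = univ

/-- The supremum of the diameters of the members. -/
def mesh {Z C : Type*} [MetricSpace Z] (𝒰 : C → Set (Set Z)) : ℝ≥0∞ :=
  ⨆ c, ⨆ U ∈ 𝒰 c, Metric.ediam U

/-- The Lebesgue number `inf_z min (sup_U dist (z, Z \ U), mesh)`;
the distance to the empty set is `∞`. -/
def lebesgueNumber {Z C : Type*} [MetricSpace Z] (𝒰 : C → Set (Set Z)) : ℝ≥0∞ :=
  ⨅ z : Z, min (⨆ c, ⨆ U ∈ 𝒰 c, Metric.infEDist z Uᶜ) (mesh 𝒰)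

/-- The property whose minimal `m` is the capacity dimension. -/
def CapacityProperty (Z : Type*) [MetricSpace Z] (m : ℕ) : Prop :=
  ∃ δ : ℝ, 0 < δ ∧ ∃ τ₀ : ℝ, 0 < τ₀ ∧ ∀ τ : ℝ, 0 < τ → τ < τ₀ →
    ∃ 𝒰 : Fin (m + 1) → Set (Set Z), IsColoredOpenCover 𝒰 ∧
      mesh 𝒰 ≤ ENNReal.ofReal τ ∧ ENNReal.ofReal (δ * τ) ≤ lebesgueNumber 𝒰

/-- The capacity dimension (`⊤` if no `m` has the required property). -/
def cdim (Z : Type*) [MetricSpace Z] : ℕ∞ :=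
  ⨅ m ∈ {m : ℕ | CapacityProperty Z m}, (m : ℕ∞)

/-! ### Hyperbolic approximations -/

/-- Distinct points of `S` have distance at least `a`. -/
def IsSep {Z : Type*} [MetricSpace Z] (a : ℝ) (S : Set Z) : Prop :=
  S.Pairwise fun x y => a ≤ dist x y

/-- The data of a hyperbolic approximation of `Z` with parameter `r`: a maximal `r ^ k`-separated
set `net k` for every integer `k ≥ k₀`, where `k₀` is the largest integer with
`diam Z < r ^ k₀`. -/
structure HypApprox (Z : Type*) [MetricSpace Z] (r : ℝ) where
  r_pos : 0 < r
  r_le : r ≤ 1 / 6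
  k₀ : ℤ
  isGreatest_k₀ : IsGreatest {k : ℤ | Metric.diam (univ : Set Z) < r ^ k} k₀
  net : ℤ → Set Z
  maximal_net : ∀ k, k₀ ≤ k → Maximal (IsSep (r ^ k)) (net k)

namespace HypApprox

variable {Z : Type*} [MetricSpace Z] {r : ℝ}

/-- Vertices: the disjoint union of the nets, as pairs (level, point). -/
def Vertex (X : HypApprox Z r) : Type _ :=
  {p : ℤ × Z // X.k₀ ≤ p.1 ∧ p.2 ∈ X.net p.1}

variable {X : HypApprox Z r}

def Vertex.level (v : X.Vertex) : ℤ := v.1.1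

def Vertex.point (v : X.Vertex) : Z := v.1.2

/-- The ball `B(v)`. -/
def Vertex.ball (v : X.Vertex) : Set Z := Metric.ball v.point (2 * r ^ v.level)

def Vertex.closedBall (v : X.Vertex) : Set Z := Metric.closedBall v.point (2 * r ^ v.level)

/-- Horizontal edges join vertices of one level whose closed balls meet; radial edges join vertices
of neighboring levels such that the ball of the upper level lies in the ball of the lower one. -/
def graph (X : HypApprox Z r) : SimpleGraph X.Vertex where
  Adj v w := v ≠ w ∧
    ((v.level = w.level ∧ (v.closedBall ∩ w.closedBall).Nonempty) ∨
      (w.level = v.level + 1 ∧ w.ball ⊆ v.ball) ∨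
      (v.level = w.level + 1 ∧ v.ball ⊆ w.ball))
  symm := ⟨fun v w h => ⟨h.1.symm, by
    rcases h.2 with ⟨h1, h2⟩ | h1 | h1
    · exact Or.inl ⟨h1.symm, by rwa [inter_comm]⟩
    · exact Or.inr (Or.inr h1)
    · exact Or.inr (Or.inl h1)⟩⟩
  loopless := ⟨fun v h => h.1 rfl⟩

/-- The path metric on the vertex set. -/
def vdist (X : HypApprox Z r) (v w : X.Vertex) : ℝ := (X.graph.dist v w : ℝ)

/-- The set `B(U)` for a covering element `U` of level `j`: the union of the balls `B(v)`, `v` of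
level `j + 1`, which meet `U`. -/
def hull (X : HypApprox Z r) (j : ℕ) (U : Set Z) : Set Z :=
  ⋃ v ∈ {v : X.Vertex | v.level = (j : ℤ) + 1 ∧ (v.ball ∩ U).Nonempty}, v.ball

/-- Vertices of one level `j` at distance `< 2 r ^ (j - 2)` in `Z` get different colors. -/
def IsProperColoring (X : HypApprox Z r) {F : Type*} (μ : X.Vertex → F) : Prop :=
  ∀ v w : X.Vertex, v ≠ w → v.level = w.level →
    dist v.point w.point < 2 * r ^ (v.level - 2) → μ v ≠ μ w

end HypApprox

/-- A sequence of colored open coverings of `Z`, `𝒰 j c` being the members of level `j` and of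
color `c`, which is adapted to the hyperbolic approximation `X`. Members of different levels are
considered as different even if they are equal as sets. -/
structure IsAdapted {Z C : Type*} [MetricSpace Z] {r : ℝ} (X : HypApprox Z r)
    (𝒰 : ℕ → C → Set (Set Z)) : Prop where
  r_lt : r < min (Metric.diam (univ : Set Z)) (1 / Metric.diam (univ : Set Z))
  isCover : ∀ j, IsColoredOpenCover (𝒰 j)
  nonempty : ∀ j c, ∀ U ∈ 𝒰 j c, U.Nonempty
  zero : ∀ c, 𝒰 0 c = {univ}
  mesh_lt : ∀ j, 1 ≤ j → mesh (𝒰 j) < ENNReal.ofReal (r ^ j)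
  ball_subset : ∀ (j : ℕ) (v : X.Vertex), v.level = (j : ℤ) + 1 →
    ∃ c, ∃ U ∈ 𝒰 j c, v.ball ⊆ U
  separation : ∀ (c : C) (j j' : ℕ) (U U' : Set Z), U ∈ 𝒰 j c → U' ∈ 𝒰 j' c → j' ≤ j →
    (j, U) ≠ (j', U') → X.hull j U ⊆ U' ∨ X.hull j U ∩ U' = ∅

/-! ### The tree of words -/

/-- The tree `T_Ω` of finite words in `Ω`; two words are adjacent iff one is obtained from the
other by erasing the last letter. -/
def wordTree (Ω : Type*) : SimpleGraph (List Ω) where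
  Adj w w' := (∃ a, w' = w ++ [a]) ∨ (∃ a, w = w' ++ [a])
  symm := ⟨fun _ _ h => h.symm⟩
  loopless := ⟨fun w h => by rcases h with ⟨a, h⟩ | ⟨a, h⟩ <;> simp at h⟩

/-- The `ℓ₁` product metric on a finite power of `T_Ω`. -/
def prodDist {C Ω : Type*} [Fintype C] (x y : C → List Ω) : ℝ :=
  ∑ c, ((wordTree Ω).dist (x c) (y c) : ℝ)

/-! ### The diary -/

/-- The pages: words of precisely `κ` letters, or words of fewer than `κ` letters (understood as
concluded by the symbol `⋆`). -/
abbrev Page (κ : ℕ) (L : Type*) : Type _ :=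
  List.Vector L κ ⊕ (Σ n : Fin κ, List.Vector L n)

/-- The page written when `l` lists the days not yet described, the most recent one first. -/
def writePage {L : Type*} (κ : ℕ) (l : List L) : Page κ L :=
  if h : κ ≤ l.length then
    Sum.inl ⟨l.take κ, by simp [h]⟩
  else
    Sum.inr ⟨⟨l.length, by omega⟩, ⟨l, rfl⟩⟩

/-- The diary of a sentence, given as the list of its words, each one together with the stop sign
that terminates it. `rest` lists the days not yet described, the most recent one first. A page is
written before the stop sign of its own day is added to `rest`. -/
def diaryFrom {L : Type*} (κ : ℕ) : List L → List (List L × L) → List (Page κ L)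
  | _, [] => []
  | rest, (w, s) :: α =>
      writePage κ (w.reverse ++ rest) ::
        diaryFrom κ (s :: (w.reverse ++ rest).drop κ) α

def diary {L : Type*} (κ : ℕ) (α : List (List L × L)) : List (Page κ L) :=
  diaryFrom κ [] α

/-! ### The Morse-Thue sequence -/

/-- The words obtained from `0` by iterating the substitution `0 → 01`, `1 → 10`. -/
def morseThueWord : ℕ → List Bool
  | 0 => [false]
  | k + 1 => (morseThueWord k).flatMap fun b => [b, !b]

/-- The Morse-Thue sequence, i.e. the limit of the nested words `morseThueWord k` (which have
`2 ^ k` letters, so that the letter of index `n` can be read off from the `n`-th word). -/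
def morseThue (n : ℕ) : Bool := (morseThueWord n).getD n false

/-! ### Colored trees -/

/-- The vertices of the tree `T_c`, as pairs (index of the covering, covering element). -/
def TreeVertex {Z C : Type*} (𝒰 : ℕ → C → Set (Set Z)) (c : C) : Type _ :=
  {p : ℕ × Set Z // p.2 ∈ 𝒰 p.1 c}

namespace TreeVertex

variable {Z C : Type*} {𝒰 : ℕ → C → Set (Set Z)} {c : C}

def index (U : TreeVertex 𝒰 c) : ℕ := U.1.1

def carrier (U : TreeVertex 𝒰 c) : Set Z := U.1.2

/-- `U'` is an ancestor of `U`. -/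
def IsAncestor (U' U : TreeVertex 𝒰 c) : Prop :=
  U'.index < U.index ∧ U.carrier ⊆ U'.carrier

/-- `U'` and `U` form an edge of `T_c` in which `U'` is the ancestor: it is the ancestor of `U` of
maximal level. -/
def IsParent (U' U : TreeVertex 𝒰 c) : Prop :=
  IsAncestor U' U ∧ ∀ U'' : TreeVertex 𝒰 c, IsAncestor U'' U → U''.index ≤ U'.index

/-- The level of a vertex of `T_c`. The root has the same level `k₀` as the root of the hyperbolic
approximation (so level `0` if `diam Z < 1`), any other vertex has the index of its covering. -/
def level (k₀ : ℤ) (U : TreeVertex 𝒰 c) : ℤ := if U.index = 0 then k₀ else U.index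

end TreeVertex

namespace HypApprox

variable {Z : Type*} [MetricSpace Z] {r : ℝ}

/-- Every point has distance `≤ r ^ k` to some vertex of level `k`, so it lies in its ball. -/
theorem exists_mem_ball (X : HypApprox Z r) (z : Z) (k : ℤ) (hk : X.k₀ ≤ k) :
    ∃ v : X.Vertex, v.level = k ∧ z ∈ v.ball := by
  have hr : 0 < r ^ k := zpow_pos X.r_pos k
  by_contra! hcon
  have hfar : ∀ x ∈ X.net k, r ^ k ≤ dist z x := by
    intro x hx
    have := hcon ⟨(k, x), hk, hx⟩ rfl
    simp only [Vertex.ball, Vertex.point, Vertex.level, Metric.mem_ball, not_lt] at this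
    linarith
  have hz : z ∉ X.net k := fun h => by
    have := hfar z h
    rw [dist_self] at this
    linarith
  have hsep : IsSep (r ^ k) (insert z (X.net k)) := by
    refine (X.maximal_net k hk).prop.insert ?_
    intro x hx _
    exact ⟨hfar x hx, by rw [dist_comm]; exact hfar x hx⟩
  exact hz ((X.maximal_net k hk).le_of_ge hsep (subset_insert _ _) (mem_insert _ _))

end HypApprox

namespace IsAdapted

variable {Z C : Type*} [MetricSpace Z] {r : ℝ} {X : HypApprox Z r} {𝒰 : ℕ → C → Set (Set Z)}

/-- The root `Z` of `T_c`. -/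
def root (h : IsAdapted X 𝒰) (c : C) : TreeVertex 𝒰 c :=
  ⟨(0, univ), by simp [h.zero c]⟩

theorem k₀_nonpos (h : IsAdapted X 𝒰) : X.k₀ ≤ 0 := by
  by_contra! hk
  have h1 : Metric.diam (univ : Set Z) < r ^ X.k₀ := X.isGreatest_k₀.1
  have h2 : r ^ X.k₀ ≤ r ^ (1 : ℤ) :=
    zpow_le_zpow_right_of_le_one₀ X.r_pos (by linarith [X.r_le]) (by omega)
  have h3 := lt_min_iff.1 h.r_lt
  rw [zpow_one] at h2
  linarith [h3.1]

theorem k₀_le_level (h : IsAdapted X 𝒰) {c : C} (U : TreeVertex 𝒰 c) :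
    X.k₀ ≤ U.level X.k₀ := by
  unfold TreeVertex.level
  have := h.k₀_nonpos
  split_ifs <;> omega

theorem exists_parent (h : IsAdapted X 𝒰) {c : C} (U : TreeVertex 𝒰 c) (hU : U.index ≠ 0) :
    ∃ U' : TreeVertex 𝒰 c, U'.IsParent U := by
  classical
  let P : ℕ → Prop := fun i => ∃ U' : TreeVertex 𝒰 c, U'.IsAncestor U ∧ U'.index = i
  have h0 : P 0 := ⟨h.root c, ⟨Nat.pos_of_ne_zero hU, subset_univ _⟩, rfl⟩
  obtain ⟨U', hU', hi⟩ := Nat.findGreatest_spec (P := P) (Nat.zero_le U.index) h0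
  refine ⟨U', hU', fun U'' hU'' => ?_⟩
  rw [hi]
  exact Nat.le_findGreatest hU''.1.le ⟨U'', hU'', rfl⟩

/-- The neighbor of `U` (not the root) on the way to the root. -/
def parent (h : IsAdapted X 𝒰) {c : C} (U : TreeVertex 𝒰 c) (hU : U.index ≠ 0) :
    TreeVertex 𝒰 c :=
  (h.exists_parent U hU).choose

theorem parent_spec (h : IsAdapted X 𝒰) {c : C} (U : TreeVertex 𝒰 c) (hU : U.index ≠ 0) :
    (h.parent U hU).IsParent U :=
  (h.exists_parent U hU).choose_spec

/-! ### The map into the product of colored trees -/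

/-- `U` contains the ball `B(v)`, its level is at most `ℓ(v) - 1`, and is maximal with this
property. -/
def IsImage {c : C} (v : X.Vertex) (U : TreeVertex 𝒰 c) : Prop :=
  (v.ball ⊆ U.carrier ∧ U.level X.k₀ ≤ v.level - 1) ∧
    ∀ U' : TreeVertex 𝒰 c, v.ball ⊆ U'.carrier → U'.level X.k₀ ≤ v.level - 1 →
      U'.level X.k₀ ≤ U.level X.k₀

theorem exists_isImage (h : IsAdapted X 𝒰) (c : C) (v : X.Vertex) (hv : v.level ≠ X.k₀) :
    ∃ U : TreeVertex 𝒰 c, IsImage v U := by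
  have hlt : X.k₀ < v.level := lt_of_le_of_ne v.2.1 (Ne.symm hv)
  obtain ⟨m, ⟨U, h1, h2, h3⟩, hm⟩ := Int.exists_greatest_of_bdd
    (P := fun i => ∃ U : TreeVertex 𝒰 c,
      v.ball ⊆ U.carrier ∧ U.level X.k₀ ≤ v.level - 1 ∧ U.level X.k₀ = i)
    ⟨v.level - 1, fun _ ⟨_, _, h2, h3⟩ => h3 ▸ h2⟩
    ⟨X.k₀, h.root c, subset_univ _, by simp [TreeVertex.level, root, TreeVertex.index]; omega,
      by simp [TreeVertex.level, root, TreeVertex.index]⟩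
  exact ⟨U, ⟨h1, h2⟩, fun U' h1' h2' => h3 ▸ hm _ ⟨U', h1', h2', rfl⟩⟩

open Classical in
/-- The map `f_c : V → T_c`. -/
def colorMap (h : IsAdapted X 𝒰) (c : C) (v : X.Vertex) : TreeVertex 𝒰 c :=
  if hv : v.level = X.k₀ then h.root c else (h.exists_isImage c v hv).choose

/-- The product map `f : V → ∏ T_c`. -/
def prodMap (h : IsAdapted X 𝒰) (v : X.Vertex) : ∀ c, TreeVertex 𝒰 c := fun c => h.colorMap c v

end IsAdapted

/-! ### Labelling and the diary maps -/

/-- The alphabet `A'` of the nonempty subsets of `F`. -/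
abbrev SubsetLetter (F : Type*) : Type _ := {s : Set F // s.Nonempty}

/-- The decorated letters: letters of `A'` or the stop sign (`none`), with a decoration from
`{0, 1}`. -/
abbrev Letter (F : Type*) : Type _ := Option (SubsetLetter F) × Bool

namespace IsAdapted

variable {Z C : Type*} [MetricSpace Z] {r : ℝ} {X : HypApprox Z r} {𝒰 : ℕ → C → Set (Set Z)}
  {F : Type*}

/-- The set of the colors `μ v` of the vertices `v` of level `k + 1` whose balls meet `U`. -/
def colorSet (h : IsAdapted X 𝒰) (μ : X.Vertex → F) {c : C} (U : TreeVertex 𝒰 c) (k : ℤ)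
    (hk : X.k₀ ≤ k) : SubsetLetter F :=
  ⟨{a | ∃ v : X.Vertex, v.level = k + 1 ∧ (v.ball ∩ U.carrier).Nonempty ∧ μ v = a}, by
    obtain ⟨z, hz⟩ := h.nonempty _ _ _ U.2
    obtain ⟨v, hv, hzv⟩ := X.exists_mem_ball z (k + 1) (by omega)
    exact ⟨μ v, v, hv, ⟨z, hzv, hz⟩, rfl⟩⟩

/-- The word attached to the edge between `U` and its ancestor `U'`: one decorated letter for each
level `k` with `ℓ(U') + 1 ≤ k ≤ ℓ(U)`. -/
def edgeWord (h : IsAdapted X 𝒰) (μ : X.Vertex → F) {c : C} (U' U : TreeVertex 𝒰 c) :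
    List (Letter F) :=
  List.ofFn fun i : Fin (U.level X.k₀ - U'.level X.k₀).toNat =>
    (some (h.colorSet μ U (U'.level X.k₀ + 1 + (i : ℤ)) (by
        have := h.k₀_le_level U'
        omega)),
      morseThue (U'.level X.k₀ + 1 + (i : ℤ)).toNat)

/-- The stop sign terminating the last word of the sentence of `U`; its level is the level of the
last letter of this word, that is `ℓ(U)`. -/
def stopSign (X : HypApprox Z r) (F : Type*) {c : C} (U : TreeVertex 𝒰 c) : Letter F :=
  (none, morseThue (U.level X.k₀).toNat)

/-- The decorated sentence `α(U)`: the words, with their stop signs, attached to the consecutive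
edges of the path in `T_c` from the root to `U`. -/
def sentence (h : IsAdapted X 𝒰) (μ : X.Vertex → F) {c : C} (U : TreeVertex 𝒰 c) :
    List (List (Letter F) × Letter F) :=
  if hU : U.index = 0 then []
  else h.sentence μ (h.parent U hU) ++
    [(h.edgeWord μ (h.parent U hU) U, stopSign X F U)]
termination_by U.index
decreasing_by exact (h.parent_spec U hU).1.1

/-- The product `ψ : ∏ T_c → T_Ω ^ C` of the diary maps `ψ_c : T_c → T_Ω`, where `Ω` is the finite
set of decorated pages. -/
def prodDiary (h : IsAdapted X 𝒰) (μ : X.Vertex → F) (κ : ℕ) (U : ∀ c, TreeVertex 𝒰 c) :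
    C → List (Page κ (Letter F)) :=
  fun c => diary κ (h.sentence μ (U c))

end IsAdapted

end

end AliceDiary

open AliceDiary

/-!
Upper bound: `f_c` maps adjacent vertices of `X` to vertices of `T_c` at a bounded distance, and the
diary of an initial part of a sentence is an initial part of its diary.

Lower bound: let `l` be the branch level of `v` and `v'`, at which their ways towards the root of
`X` have come close to each other, and let `ℓ(v') ≤ ℓ(v)`. By property (2) of adapted coverings,
every level between `l` and `ℓ(v)` is the level of a vertex of some tree `T_c` below the meet of
`f_c(v)` and `f_c(v')`. So the paths below the meets are long in total, and it suffices that in each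
color the common initial part of the two diaries reaches at most about `3 (ℓ(v) - l) / (κ - 1)`
edges below the meet. If it reaches further, then among the vertices on this part of the path to
`f_c(v)`, the vertex `Y` maximizing `(κ - 1) * depth - level` has a sentence whose last words are
so short on the average that its diary determines more than `2 (ℓ(v) - l)` of its last letters, or
all of them. They are also the last letters at the vertex `Y'` of the same depth on the path to
`f_c(v')`. Since the Morse-Thue sequence contains no cubes, `Y` and `Y'` have the same level. Since
`μ` is proper, equal letters force points of `Y` and `Y'` which are close at the scale of one level
to be close at the scale of the next one. So `v` and `v'` are still close at the level of `Y`, which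
exceeds `l`: a contradiction.

Adapted coverings: eroding the coverings given by the capacity dimension yields, at the scale
`r ^ j`, coverings whose members of the same color are far from each other. For property (3) every
member is enlarged by the chains of members of higher levels which start in it. As the scales
decrease geometrically, these chains are short.
-/

namespace AliceDiary

/-! ### The Morse-Thue sequence -/

theorem getElem?_flatMap_pair_two_mul {α : Type*} (f : α → α) (l : List α) (i : ℕ) :
    (l.flatMap fun a => [a, f a])[2 * i]? = l[i]? := by
  induction l generalizing i with
  | nil => simp
  | cons a l ih => cases i <;> simp [Nat.mul_add, ih]

theorem getElem?_flatMap_pair_two_mul_add_one {α : Type*} (f : α → α) (l : List α) (i : ℕ) :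
    (l.flatMap fun a => [a, f a])[2 * i + 1]? = l[i]?.map f := by
  induction l generalizing i with
  | nil => simp
  | cons a l ih => cases i <;> simp [Nat.mul_add, ih]

theorem length_morseThueWord (k : ℕ) : (morseThueWord k).length = 2 ^ k := by
  induction k with
  | zero => rfl
  | succ k ih => simp [morseThueWord, List.length_flatMap, ih, pow_succ]

theorem morseThueWord_prefix_succ (k : ℕ) : morseThueWord k <+: morseThueWord (k + 1) := by
  induction k with
  | zero => exact ⟨[true], rfl⟩
  | succ k ih => exact ih.flatMap _

theorem morseThueWord_prefix_of_le {k l : ℕ} (h : k ≤ l) : morseThueWord k <+: morseThueWord l := by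
  induction l, h using Nat.le_induction with
  | base => exact List.prefix_rfl
  | succ l _ ih => exact ih.trans (morseThueWord_prefix_succ l)

theorem getElem?_morseThueWord {k i : ℕ} (h : i < 2 ^ k) :
    (morseThueWord k)[i]? = some (morseThue i) := by
  have hk : i < (morseThueWord k).length := by rwa [length_morseThueWord]
  have hi : i < (morseThueWord i).length := by
    rw [length_morseThueWord]
    exact Nat.lt_two_pow_self
  have hki : (morseThueWord k)[i] = (morseThueWord i)[i] := by
    rcases le_total k i with hle | hle
    · exact (morseThueWord_prefix_of_le hle).getElem hk
    · exact ((morseThueWord_prefix_of_le hle).getElem hi).symm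
  rw [morseThue, List.getElem?_eq_getElem hk, hki, List.getD_eq_getElem _ _ hi]

theorem morseThue_two_mul (n : ℕ) : morseThue (2 * n) = morseThue n := by
  have hn : n < 2 ^ n := Nat.lt_two_pow_self
  have h := getElem?_morseThueWord (k := n + 1) (i := 2 * n) (by omega)
  rw [morseThueWord, getElem?_flatMap_pair_two_mul not, getElem?_morseThueWord hn] at h
  exact (Option.some_injective _ h).symm

theorem morseThue_two_mul_add_one (n : ℕ) : morseThue (2 * n + 1) = !morseThue n := by
  have hn : n < 2 ^ n := Nat.lt_two_pow_self
  have h := getElem?_morseThueWord (k := n + 1) (i := 2 * n + 1) (by omega)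
  rw [morseThueWord, getElem?_flatMap_pair_two_mul_add_one not, getElem?_morseThueWord hn] at h
  exact (Option.some_injective _ h).symm

theorem morseThue_ne_succ_of_even {p : ℕ} (hp : Even p) : morseThue p ≠ morseThue (p + 1) := by
  obtain ⟨m, rfl⟩ := hp.two_dvd
  simp [morseThue_two_mul, morseThue_two_mul_add_one]

theorem exists_morseThue_ne_succ (a : ℕ) :
    ∃ p, a ≤ p ∧ p < a + 2 ∧ morseThue p ≠ morseThue (p + 1) := by
  rcases Nat.even_or_odd a with ha | ha
  · exact ⟨a, le_rfl, by omega, morseThue_ne_succ_of_even ha⟩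
  · exact ⟨a + 1, by omega, by omega, morseThue_ne_succ_of_even ha.add_one⟩

theorem exists_morseThue_eq_succ (a : ℕ) :
    ∃ p, a ≤ p ∧ p < a + 5 ∧ morseThue p = morseThue (p + 1) := by
  by_contra! hne
  have hperiod : ∀ p, a ≤ p → p < a + 4 → morseThue p = morseThue (p + 2) := fun p h1 h2 =>
    (Bool.eq_not_of_ne (hne p h1 (by omega))).trans
      (Bool.eq_not_of_ne (hne (p + 1) (by omega) (by omega)).symm).symm
  obtain ⟨m, hm1, hm2, hm⟩ := exists_morseThue_ne_succ ((a + 1) / 2)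
  apply hm
  rw [← morseThue_two_mul m, ← morseThue_two_mul (m + 1)]
  exact hperiod (2 * m) (by omega) (by omega)

theorem morseThue_cube_free {s : ℕ} (hs : 0 < s) (a : ℕ) :
    ∃ k, a ≤ k ∧ k < a + 2 * s ∧ morseThue k ≠ morseThue (k + s) := by
  induction s using Nat.strong_induction_on generalizing a with
  | _ s ih =>
    rcases Nat.even_or_odd' s with ⟨u, rfl | rfl⟩
    · obtain ⟨k, hk1, hk2, hk⟩ := ih u (by omega) (by omega) ((a + 1) / 2)
      refine ⟨2 * k, by omega, by omega, ?_⟩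
      rwa [← mul_add, morseThue_two_mul, morseThue_two_mul]
    by_contra! hper
    obtain rfl | hu := Nat.eq_zero_or_pos u
    · obtain ⟨p, hp1, hp2, hp⟩ := exists_morseThue_ne_succ a
      exact hp (hper p hp1 hp2)
    -- Equal neighbors start at an odd index; an odd period would move one of them to an even index.
    obtain ⟨p, hp1, hp2, hp⟩ := exists_morseThue_eq_succ (a + (2 * u + 1))
    obtain ⟨q, rfl⟩ : ∃ q, p = q + (2 * u + 1) := ⟨p - (2 * u + 1), by omega⟩
    have hodd : Odd (q + (2 * u + 1)) := by
      rw [← Nat.not_even_iff_odd]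
      exact fun h => morseThue_ne_succ_of_even h hp
    refine morseThue_ne_succ_of_even (p := q) (by grind) ?_
    rw [hper q (by omega) (by omega), hper (q + 1) (by omega) (by omega), hp, add_right_comm]

/-! ### The tree of words -/

section WordTree

variable {Ω : Type*}

theorem exists_walk_append (w e : List Ω) :
    ∃ p : (wordTree Ω).Walk w (w ++ e), p.length = e.length := by
  induction e generalizing w with
  | nil => exact ⟨SimpleGraph.Walk.nil.copy rfl (by simp), by simp⟩
  | cons a e ih =>
    obtain ⟨p, hp⟩ := ih (w ++ [a])
    have hadj : (wordTree Ω).Adj w (w ++ [a]) := Or.inl ⟨a, rfl⟩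
    exact ⟨(SimpleGraph.Walk.cons hadj p).copy rfl (by simp), by simp [hp]⟩

theorem wordTree_dist_append_le (w e : List Ω) : (wordTree Ω).dist w (w ++ e) ≤ e.length := by
  obtain ⟨p, hp⟩ := exists_walk_append w e
  exact hp ▸ SimpleGraph.dist_le p

theorem wordTree_connected : (wordTree Ω).Connected := by
  have hnil (w : List Ω) : (wordTree Ω).Reachable [] w := ⟨(exists_walk_append [] w).choose⟩
  exact ⟨fun v w => (hnil v).symm.trans (hnil w)⟩

theorem exists_common_prefix_of_walk {v w : List Ω} (p : (wordTree Ω).Walk v w) :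
    ∃ u, u <+: v ∧ u <+: w ∧ v.length + w.length ≤ p.length + 2 * u.length := by
  induction p with
  | nil => exact ⟨_, List.prefix_rfl, List.prefix_rfl, by grind⟩
  | @cons v v' w hadj p ih =>
    obtain ⟨u, hv, hw, hlen⟩ := ih
    rw [SimpleGraph.Walk.length_cons]
    rcases hadj with ⟨a, rfl⟩ | ⟨a, rfl⟩
    · rw [List.length_append, List.length_singleton] at hlen
      rcases List.prefix_concat_iff.1 hv with rfl | hv
      · rw [List.length_append, List.length_singleton] at hlen
        exact ⟨v, List.prefix_rfl, (List.prefix_append _ _).trans hw, by omega⟩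
      · exact ⟨u, hv, hw, by omega⟩
    · refine ⟨u, hv.trans (List.prefix_append _ _), hw, ?_⟩
      rw [List.length_append, List.length_singleton]
      omega

theorem exists_common_prefix (v w : List Ω) :
    ∃ u, u <+: v ∧ u <+: w ∧ v.length + w.length ≤ (wordTree Ω).dist v w + 2 * u.length := by
  obtain ⟨p, hp⟩ := wordTree_connected.exists_walk_length_eq_dist v w
  exact hp ▸ exists_common_prefix_of_walk p

theorem append_prefix_iff_of_adj {v w x : List Ω} {a : Ω} (hadj : (wordTree Ω).Adj v w)
    (hne : s(v, w) ≠ s(x, x ++ [a])) : x ++ [a] <+: v ↔ x ++ [a] <+: w := by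
  have hconcat {v : List Ω} {b : Ω} (hne : s(v, v ++ [b]) ≠ s(x, x ++ [a])) :
      x ++ [a] <+: v ↔ x ++ [a] <+: v ++ [b] := by
    rw [List.prefix_concat_iff, or_iff_right]
    intro heq
    obtain ⟨rfl, hab⟩ := List.append_inj' heq rfl
    exact hne (by rw [hab])
  rcases hadj with ⟨b, rfl⟩ | ⟨b, rfl⟩
  · exact hconcat hne
  · exact (hconcat (Sym2.eq_swap ▸ hne)).symm

theorem isBridge_append (x : List Ω) (a : Ω) : (wordTree Ω).IsBridge s(x, x ++ [a]) := by
  have hinv {v w : List Ω} (p : ((wordTree Ω).deleteEdges {s(x, x ++ [a])}).Walk v w) :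
      x ++ [a] <+: v ↔ x ++ [a] <+: w := by
    induction p with
    | nil => rfl
    | cons hadj _ ih =>
      rw [SimpleGraph.deleteEdges_adj, mem_singleton_iff] at hadj
      exact (append_prefix_iff_of_adj hadj.1 hadj.2).trans ih
  rw [SimpleGraph.isBridge_iff]
  rintro ⟨p⟩
  simpa using ((hinv p).2 List.prefix_rfl).length_le

theorem wordTree_isTree : (wordTree Ω).IsTree := by
  refine ⟨wordTree_connected, SimpleGraph.isAcyclic_iff_forall_adj_isBridge.2 ?_⟩
  rintro v w (⟨a, rfl⟩ | ⟨a, rfl⟩)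
  · exact isBridge_append v a
  · exact Sym2.eq_swap ▸ isBridge_append w a

theorem wordTree_neighborSet_finite [Finite Ω] (w : List Ω) :
    ((wordTree Ω).neighborSet w).Finite := by
  refine ((finite_singleton w.dropLast).union (finite_range fun a => w ++ [a])).subset ?_
  rintro u (⟨a, rfl⟩ | ⟨a, rfl⟩)
  · exact Or.inr ⟨a, rfl⟩
  · exact Or.inl List.dropLast_concat.symm

end WordTree

/-! ### Reading the diary -/

section Diary

variable {L : Type*}

/-- All symbols of a sentence, the most recent one first. -/
def text (α : List (List L × L)) : List L := (α.flatMap fun p => p.1 ++ [p.2]).reverse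

/-- The symbols of a sentence without the stop signs, in reading order. -/
def letters (α : List (List L × L)) : List L := α.flatMap Prod.fst

/-- The test `isStop` recognizes the stop signs among the symbols of the sentence. -/
def StopsMarked (isStop : L → Bool) (α : List (List L × L)) : Prop :=
  ∀ p ∈ α, (∀ x ∈ p.1, isStop x = false) ∧ isStop p.2 = true

@[simp]
theorem text_nil : text ([] : List (List L × L)) = [] := rfl

theorem text_append (α β : List (List L × L)) : text (α ++ β) = text β ++ text α := by
  simp [text]

theorem text_cons (p : List L × L) (α : List (List L × L)) :
    text (p :: α) = text α ++ p.2 :: p.1.reverse := by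
  simp [text]

theorem letters_append (α β : List (List L × L)) : letters (α ++ β) = letters α ++ letters β :=
  List.flatMap_append

theorem length_text (α : List (List L × L)) :
    (text α).length = (letters α).length + α.length := by
  induction α with
  | nil => rfl
  | cons p α ih =>
    simp [text_cons, letters, ih]
    omega

theorem length_diaryFrom (κ : ℕ) (rest : List L) (α : List (List L × L)) :
    (diaryFrom κ rest α).length = α.length := by
  induction α generalizing rest with
  | nil => rfl
  | cons p α ih => simp [diaryFrom, ih]

theorem length_diary (κ : ℕ) (α : List (List L × L)) : (diary κ α).length = α.length :=
  length_diaryFrom κ [] α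

theorem diaryFrom_prefix (κ : ℕ) (rest : List L) (α β : List (List L × L)) :
    diaryFrom κ rest α <+: diaryFrom κ rest (α ++ β) := by
  induction α generalizing rest with
  | nil => exact List.nil_prefix
  | cons p α ih => exact (List.prefix_cons_inj _).2 (ih _)

theorem diary_prefix (κ : ℕ) {α β : List (List L × L)} (h : α <+: β) :
    diary κ α <+: diary κ β := by
  obtain ⟨γ, rfl⟩ := h
  exact diaryFrom_prefix κ [] α γ

theorem take_eq_of_writePage_eq {κ : ℕ} {l l' : List L} (h : writePage κ l = writePage κ l') :
    l.take κ = l'.take κ := by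
  have hval (p q : Σ n : Fin κ, List.Vector L n) (hpq : p = q) : p.2.1 = q.2.1 := by rw [hpq]
  unfold writePage at h
  split_ifs at h with h1 h2
  · exact congrArg Subtype.val (Sum.inl.inj h)
  · exact congrArg (List.take κ) (hval _ _ (Sum.inr.inj h))

theorem take_eq_of_diaryFrom_cons_eq {κ : ℕ} {rest rest' : List L} {p p' : List L × L}
    {σ σ' : List (List L × L)} (h : diaryFrom κ rest (p :: σ) = diaryFrom κ rest' (p' :: σ')) :
    (p.1.reverse ++ rest).take κ = (p'.1.reverse ++ rest').take κ :=
  take_eq_of_writePage_eq (List.cons.inj h).1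

theorem diaryFrom_eq_of_cons_eq {κ : ℕ} {rest rest' : List L} {p p' : List L × L}
    {σ σ' : List (List L × L)} (h : diaryFrom κ rest (p :: σ) = diaryFrom κ rest' (p' :: σ')) :
    diaryFrom κ (p.2 :: (p.1.reverse ++ rest).drop κ) σ =
      diaryFrom κ (p'.2 :: (p'.1.reverse ++ rest').drop κ) σ' :=
  (List.cons.inj h).2

variable {isStop : L → Bool}

theorem StopsMarked.of_append_left {α β : List (List L × L)} (h : StopsMarked isStop (α ++ β)) :
    StopsMarked isStop α := fun p hp => h p (List.mem_append_left β hp)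

theorem StopsMarked.of_append_right {α β : List (List L × L)} (h : StopsMarked isStop (α ++ β)) :
    StopsMarked isStop β := fun p hp => h p (List.mem_append_right α hp)

theorem StopsMarked.of_cons {p : List L × L} {α : List (List L × L)}
    (h : StopsMarked isStop (p :: α)) : StopsMarked isStop α :=
  fun q hq => h q (List.mem_cons_of_mem p hq)

theorem countP_text {α : List (List L × L)} (h : StopsMarked isStop α) :
    (text α).countP isStop = α.length := by
  induction α with
  | nil => rfl
  | cons p α ih =>
    obtain ⟨hw, hs⟩ := h p List.mem_cons_self
    have hw' : p.1.countP isStop = 0 := List.countP_eq_zero.2 fun x hx => by simp [hw x hx]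
    simp [text_cons, ih h.of_cons, hw', hs]

theorem filter_text {α : List (List L × L)} (h : StopsMarked isStop α) :
    (text α).filter (!isStop ·) = (letters α).reverse := by
  induction α with
  | nil => rfl
  | cons p α ih =>
    obtain ⟨hw, hs⟩ := h p List.mem_cons_self
    have hw' : p.1.filter (!isStop ·) = p.1 := List.filter_eq_self.2 fun x hx => by simp [hw x hx]
    simp [text_cons, ih h.of_cons, letters, hw', hs]

theorem exists_text_eq_cons {α : List (List L × L)} (hα : α ≠ []) (h : StopsMarked isStop α) :
    ∃ s A, text α = s :: A ∧ isStop s = true := by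
  obtain ⟨β, p, rfl⟩ := α.eq_nil_or_concat'.resolve_left hα
  exact ⟨p.2, p.1.reverse ++ text β, by simp [text], (h p (by simp)).2⟩

theorem eq_of_take_append_stop_eq {A A' Y Y' : List L} {s s' : L} {j : ℕ} (hs : isStop s = true)
    (hs' : isStop s' = true) (hc : A.countP isStop = A'.countP isStop)
    (h : (A ++ s :: Y).take (A.length + 1 + j) = (A' ++ s' :: Y').take (A.length + 1 + j)) :
    A = A' ∧ s = s' ∧ Y.take j = Y'.take j := by
  induction A generalizing A' with
  | nil => cases A' <;> grind
  | cons a A ih =>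
    rw [List.length_cons, add_right_comm _ 1 1, add_right_comm _ 1 j] at h
    cases A' with
    | nil => grind
    | cons b A' =>
      simp only [List.cons_append, List.take_succ_cons, List.cons.injEq] at h
      obtain ⟨rfl, h⟩ := h
      have := ih (by simpa [List.countP_cons] using hc) h
      simpa using this

theorem take_append_stop_add (A : List L) (s : L) (Y : List L) (j : ℕ) :
    (A ++ s :: Y).take (A.length + 1 + j) = A ++ s :: Y.take j := by
  rw [add_assoc, List.take_length_add_append, add_comm 1 j, List.take_succ_cons]

theorem take_append_stop_of_le {A : List L} {m : ℕ} (hm : m ≤ A.length) (s : L) (X : List L) :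
    (A ++ s :: X).take m = A.take m :=
  List.take_append_of_le_length hm

theorem take_add_append_stop_eq {A A' X X' : List L} {s s' : L} {κ m : ℕ} (hs : isStop s = true)
    (hs' : isStop s' = true) (hc : A.countP isStop = A'.countP isStop)
    (hX : X.take κ = X'.take κ) (hm : A.length < m)
    (h : (A ++ s :: X.drop κ).take m = (A' ++ s' :: X'.drop κ).take m) :
    (A ++ s :: X).take (m + κ) = (A' ++ s' :: X').take (m + κ) := by
  obtain ⟨j, rfl⟩ := Nat.exists_eq_add_of_lt hm
  rw [add_right_comm A.length j 1] at h ⊢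
  obtain ⟨rfl, rfl, hj⟩ := eq_of_take_append_stop_eq hs hs' hc h
  have hXj : X.take (κ + j) = X'.take (κ + j) := by rw [List.take_add, List.take_add, hX, hj]
  rw [add_assoc, add_comm j κ, take_append_stop_add, take_append_stop_add, hXj]

theorem take_append_stop_eq {A A' X X' : List L} {s s' : L} {κ m : ℕ} (hs : isStop s = true)
    (hs' : isStop s' = true) (hc : A.countP isStop = A'.countP isStop)
    (hX : X.take κ = X'.take κ)
    (h : (A ++ s :: X.drop κ).take m = (A' ++ s' :: X'.drop κ).take m) :
    (A ++ s :: X).take m = (A' ++ s' :: X').take m := by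
  have take_of_add {l l' : List L} (hl : l.take (m + κ) = l'.take (m + κ)) :
      l.take m = l'.take m := by
    simpa [List.take_take] using congrArg (List.take m) hl
  rcases lt_or_ge A.length m with hm | hm
  · exact take_of_add (take_add_append_stop_eq hs hs' hc hX hm h)
  rcases lt_or_ge A'.length m with hm' | hm'
  · exact (take_of_add (take_add_append_stop_eq hs' hs hc.symm hX.symm hm' h.symm)).symm
  · rwa [take_append_stop_of_le hm, take_append_stop_of_le hm'] at h ⊢

theorem take_tail_text_cons_eq {p p' : List L × L} {σ σ' : List (List L × L)} {rest rest' : List L}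
    {κ m : ℕ} (hl : σ.length = σ'.length) (hσ : σ ≠ []) (hp : StopsMarked isStop (p :: σ))
    (hp' : StopsMarked isStop (p' :: σ'))
    (hX : (p.1.reverse ++ rest).take κ = (p'.1.reverse ++ rest').take κ)
    (h : (text σ ++ p.2 :: (p.1.reverse ++ rest).drop κ).tail.take m =
      (text σ' ++ p'.2 :: (p'.1.reverse ++ rest').drop κ).tail.take m) :
    (text (p :: σ) ++ rest).tail.take m = (text (p' :: σ') ++ rest').tail.take m ∧
      ((text σ).length ≤ m →
        (text (p :: σ) ++ rest).tail.take (m + κ) =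
          (text (p' :: σ') ++ rest').tail.take (m + κ)) := by
  have hσ' : σ' ≠ [] := by
    rwa [← List.length_pos_iff, ← hl, List.length_pos_iff]
  obtain ⟨s, A, hA, hs⟩ := exists_text_eq_cons hσ hp.of_cons
  obtain ⟨s', A', hA', hs'⟩ := exists_text_eq_cons hσ' hp'.of_cons
  have hc : A.countP isStop = A'.countP isStop := by
    have hcount := countP_text hp.of_cons
    rw [hl, ← countP_text hp'.of_cons, hA, hA'] at hcount
    simpa [hs, hs'] using hcount
  have hp2 := (hp p List.mem_cons_self).2
  have hp2' := (hp' p' List.mem_cons_self).2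
  simp only [text_cons, hA, hA', List.cons_append, List.append_assoc, List.tail_cons,
    List.length_cons] at h ⊢
  exact ⟨take_append_stop_eq hp2 hp2' hc hX h,
    fun hm => take_add_append_stop_eq hp2 hp2' hc hX hm h⟩

/-- By `hb`, the later pages recover all symbols behind the first stop sign, and thus its position;
the first page then adds `κ` symbols more. -/
theorem take_tail_text_eq {κ : ℕ} {γ γ' : List (List L × L)} {rest rest' : List L}
    (hl : γ.length = γ'.length) (hm : StopsMarked isStop γ) (hm' : StopsMarked isStop γ')
    (hd : diaryFrom κ rest γ = diaryFrom κ rest' γ')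
    (hb : ∀ d, 1 ≤ d → (text (γ.drop d)).length ≤ κ * (γ.drop d).length) :
    (text γ ++ rest).tail.take (κ * γ.length) = (text γ' ++ rest').tail.take (κ * γ.length) := by
  induction γ generalizing γ' rest rest' with
  | nil => simp
  | cons p σ ih =>
    obtain ⟨p', σ', rfl⟩ := List.exists_cons_of_length_eq_add_one hl.symm
    have hl' : σ.length = σ'.length := Nat.succ.inj hl
    have hpage := take_eq_of_diaryFrom_cons_eq hd
    rcases eq_or_ne σ [] with rfl | hσ
    · obtain rfl := List.length_eq_zero_iff.1 hl'.symm
      simpa [text_cons] using hpage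
    · have hknown := ih hl' hm.of_cons hm'.of_cons (diaryFrom_eq_of_cons_eq hd)
        fun d hd => hb (d + 1) (by omega)
      exact (take_tail_text_cons_eq hl' hσ hm hm' hpage hknown).2 (hb 1 le_rfl)

theorem take_tail_text_append_eq {κ : ℕ} {β β' γ γ' : List (List L × L)} {rest rest' : List L}
    (hlβ : β.length = β'.length) (hl : γ.length = γ'.length) (hm : StopsMarked isStop (β ++ γ))
    (hm' : StopsMarked isStop (β' ++ γ'))
    (hd : diaryFrom κ rest (β ++ γ) = diaryFrom κ rest' (β' ++ γ'))
    (hb : ∀ d, 1 ≤ d → (text (γ.drop d)).length ≤ κ * (γ.drop d).length) :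
    (text (β ++ γ) ++ rest).tail.take (κ * γ.length) =
      (text (β' ++ γ') ++ rest').tail.take (κ * γ.length) := by
  induction β generalizing β' rest rest' with
  | nil =>
    obtain rfl := List.length_eq_zero_iff.1 hlβ.symm
    exact take_tail_text_eq hl hm hm' hd hb
  | cons p β ih =>
    obtain ⟨p', β', rfl⟩ := List.exists_cons_of_length_eq_add_one hlβ.symm
    have hlβ' : β.length = β'.length := Nat.succ.inj hlβ
    rcases eq_or_ne (β ++ γ) [] with hnil | hne
    · simp [(List.append_eq_nil_iff.1 hnil).2]
    · have hknown := ih hlβ' hm.of_cons hm'.of_cons (diaryFrom_eq_of_cons_eq hd)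
      exact (take_tail_text_cons_eq (by simp [hlβ', hl]) hne hm hm'
        (take_eq_of_diaryFrom_cons_eq hd) hknown).1

theorem eq_of_take_append_text_eq {ρ : List (List L × L)} {H H' : List L} {m : ℕ}
    (hρ : StopsMarked isStop ρ) (hc : H.countP isStop = H'.countP isStop) (hm : H.length < m)
    (h : (H ++ text ρ).take m = (H' ++ text ρ).take m) : H = H' := by
  rcases eq_or_ne ρ [] with rfl | hne
  · have hlen := congrArg List.length h
    simp only [text_nil, List.append_nil, List.length_take] at h hlen
    rwa [List.take_of_length_le hm.le, List.take_of_length_le (by omega)] at h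
  · obtain ⟨s, B, hB, hs⟩ := exists_text_eq_cons hne hρ
    obtain ⟨j, rfl⟩ := Nat.exists_eq_add_of_lt hm
    rw [hB, add_right_comm] at h
    exact (eq_of_take_append_stop_eq hs hs hc h).1

theorem exists_text_cons_eq {p : List L × L} {γ : List (List L × L)}
    (h : StopsMarked isStop (p :: γ)) :
    ∃ s H, text (p :: γ) = s :: H ∧ H.countP isStop = γ.length ∧
      H.filter (!isStop ·) = (letters (p :: γ)).reverse := by
  obtain ⟨s, H, hH, hs⟩ := exists_text_eq_cons (List.cons_ne_nil p γ) h
  refine ⟨s, H, hH, ?_, ?_⟩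
  · simpa [hH, hs] using countP_text h
  · simpa [hH, hs] using filter_text h

theorem reverse_filter_suffix {f : L → Bool} {K H l : List L} (hKH : K <+: H)
    (hH : H.filter f = l.reverse) : (K.filter f).reverse <:+ l := by
  have hK := hKH.filter f
  rwa [hH, ← List.reverse_suffix, List.reverse_reverse] at hK

theorem length_sub_countP_le {K : List L} {c : ℕ} (hc : K.countP isStop ≤ c) :
    K.length - c ≤ (K.filter (!isStop ·)).length := by
  have hlen := List.length_eq_countP_add_countP isStop (l := K)
  rw [List.countP_eq_length_filter (l := K) (p := fun a => ¬isStop a = true)] at hlen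
  simp only [Bool.not_eq_true, Bool.decide_eq_false] at hlen
  omega

theorem letters_eq_or_exists_common_suffix {κ : ℕ} {ρ σ σ' : List (List L × L)}
    (hl : σ.length = σ'.length) (hm : StopsMarked isStop (ρ ++ σ))
    (hm' : StopsMarked isStop (ρ ++ σ')) (hd : diary κ (ρ ++ σ) = diary κ (ρ ++ σ'))
    (hb : ∀ d, 2 ≤ d → (text (σ.drop d)).length ≤ κ * (σ.drop d).length) :
    letters (ρ ++ σ) = letters (ρ ++ σ') ∨
      ∃ K, (κ - 1) * (σ.length - 1) ≤ K.length ∧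
        K <:+ letters (ρ ++ σ) ∧ K <:+ letters (ρ ++ σ') := by
  rcases σ with _ | ⟨p, γ⟩
  · obtain rfl := List.length_eq_zero_iff.1 hl.symm
    exact Or.inl rfl
  obtain ⟨p', γ', rfl⟩ := List.exists_cons_of_length_eq_add_one hl.symm
  have hlγ : γ.length = γ'.length := Nat.succ.inj hl
  obtain ⟨s, H, hH, hHc, hHf⟩ := exists_text_cons_eq hm.of_append_right
  obtain ⟨s', H', hH', hHc', hHf'⟩ := exists_text_cons_eq hm'.of_append_right
  have hc : H.countP isStop = H'.countP isStop := by rw [hHc, hHc', hlγ]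
  have hknown : (H ++ text ρ).take (κ * γ.length) = (H' ++ text ρ).take (κ * γ.length) := by
    have := take_tail_text_append_eq (β := ρ ++ [p]) (β' := ρ ++ [p']) (rest := []) (rest' := [])
      (by simp) hlγ (by simpa using hm) (by simpa using hm') (by simpa [diary] using hd)
      fun d hd => hb (d + 1) (by omega)
    simpa [text_append, hH, hH'] using this
  rw [letters_append, letters_append]
  have hletters (heq : H = H') : letters (p :: γ) = letters (p' :: γ') := by
    rw [heq, hHf'] at hHf
    exact (List.reverse_injective hHf).symm
  rcases lt_or_ge H.length (κ * γ.length) with hlt | hge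
  · rw [hletters (eq_of_take_append_text_eq hm.of_append_left hc hlt hknown)]
    exact Or.inl rfl
  rcases lt_or_ge H'.length (κ * γ.length) with hlt' | hge'
  · rw [hletters (eq_of_take_append_text_eq hm.of_append_left hc.symm hlt' hknown.symm).symm]
    exact Or.inl rfl
  rw [List.take_append_of_le_length hge, List.take_append_of_le_length hge'] at hknown
  set K := H.take (κ * γ.length)
  refine Or.inr ⟨(K.filter (!isStop ·)).reverse, ?_,
    (reverse_filter_suffix (List.take_prefix _ _) hHf).trans (List.suffix_append _ _),
    (reverse_filter_suffix (hknown ▸ List.take_prefix _ _) hHf').trans (List.suffix_append _ _)⟩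
  rw [List.length_reverse, List.length_cons, Nat.add_sub_cancel, Nat.sub_mul, one_mul]
  have hKc : K.countP isStop ≤ γ.length := hHc ▸ (List.take_sublist _ H).countP_le
  have hKlen : K.length = κ * γ.length := List.length_take_of_le hge
  exact hKlen ▸ length_sub_countP_le hKc

end Diary

/-! ### Existence of hyperbolic approximations -/

theorem exists_maximal_isSep {Z : Type*} [MetricSpace Z] (a : ℝ) :
    ∃ S : Set Z, Maximal (IsSep a) S := by
  obtain ⟨S, hS⟩ := zorn_subset {S : Set Z | IsSep a S} fun c hc hchain =>
    ⟨⋃₀ c, (pairwise_sUnion hchain.directedOn).2 hc, fun _ => subset_sUnion_of_mem⟩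
  exact ⟨S, hS⟩

theorem exists_isGreatest_zpow {r D : ℝ} (hr : 0 < r) (hr1 : r < 1) (hD : 0 < D) :
    ∃ k : ℤ, IsGreatest {k : ℤ | D < r ^ k} k := by
  obtain ⟨n, hn, hn'⟩ := exists_mem_Ico_zpow hD ((one_lt_inv₀ hr).2 hr1)
  rw [inv_zpow'] at hn hn'
  refine ⟨-(n + 1), hn', fun k (hk : D < r ^ k) => ?_⟩
  have := (zpow_lt_zpow_iff_right_of_lt_one₀ hr hr1).1 (hn.trans_lt hk)
  omega

theorem nonempty_hypApprox {Z : Type*} [MetricSpace Z] {r : ℝ} (hr : 0 < r) (hr6 : r ≤ 1 / 6)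
    (hD : 0 < Metric.diam (univ : Set Z)) : Nonempty (HypApprox Z r) := by
  obtain ⟨k, hk⟩ := exists_isGreatest_zpow hr (by linarith) hD
  choose net hnet using fun k : ℤ => exists_maximal_isSep (Z := Z) (r ^ k)
  exact ⟨⟨hr, hr6, k, hk, net, fun k _ => hnet k⟩⟩

/-! ### Proper colorings of the nets -/

/-- `N` is a doubling constant of `Z`. -/
def IsDoublingWith (Z : Type*) [MetricSpace Z] (N : ℕ) : Prop :=
  ∀ (x : Z) (ρ : ℝ), 0 < ρ →
    ∃ s : Finset Z, s.card ≤ N ∧ Metric.ball x ρ ⊆ ⋃ y ∈ s, Metric.ball y (ρ / 2)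

section Coloring

variable {Z : Type*} [MetricSpace Z]

theorem IsDoublingWith.exists_cover {N : ℕ} (hN : IsDoublingWith Z N) (m : ℕ) (x : Z) {ρ : ℝ}
    (hρ : 0 < ρ) :
    ∃ s : Finset Z, s.card ≤ N ^ m ∧ Metric.ball x ρ ⊆ ⋃ y ∈ s, Metric.ball y (ρ / 2 ^ m) := by
  classical
  induction m with
  | zero => exact ⟨{x}, by simp⟩
  | succ m ih =>
    obtain ⟨s, hs, hcov⟩ := ih
    choose t ht hct using fun y : Z => hN y (ρ / 2 ^ m) (by positivity)
    refine ⟨s.biUnion t, ?_, fun z hz => ?_⟩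
    · calc (s.biUnion t).card ≤ s.card * N := Finset.card_biUnion_le_card_mul _ _ _ fun y _ => ht y
        _ ≤ N ^ m * N := Nat.mul_le_mul_right _ hs
        _ = N ^ (m + 1) := (pow_succ _ _).symm
    · obtain ⟨y, hy, hzy⟩ := mem_iUnion₂.1 (hcov hz)
      obtain ⟨w, hw, hzw⟩ := mem_iUnion₂.1 (hct y hzy)
      rw [div_div, ← pow_succ] at hzw
      exact mem_iUnion₂.2 ⟨w, Finset.mem_biUnion.2 ⟨y, hy, hw⟩, hzw⟩

theorem IsDoublingWith.encard_le {N : ℕ} (hN : IsDoublingWith Z N) {m : ℕ} {x : Z} {ρ a : ℝ}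
    (hρ : 0 < ρ) (ha : 2 * ρ ≤ 2 ^ m * a) {S : Set Z} (hS : S ⊆ Metric.ball x ρ)
    (hsep : IsSep a S) : S.encard ≤ (N ^ m : ℕ) := by
  obtain ⟨s, hs, hcov⟩ := hN.exists_cover m x hρ
  have hnear : ∀ z ∈ S, ∃ y ∈ s, z ∈ Metric.ball y (ρ / 2 ^ m) := fun z hz => by
    simpa using hcov (hS hz)
  choose! g hgs hg using hnear
  have hinj : InjOn g S := by
    intro z hz w hw hzw
    by_contra hne
    have hz' := Metric.mem_ball.1 (hg z hz)
    have hw' := Metric.mem_ball.1 (hg w hw)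
    rw [← hzw] at hw'
    have hle : 2 * (ρ / 2 ^ m) ≤ a := by
      rw [← mul_div_assoc, div_le_iff₀ (by positivity)]
      linarith
    linarith [hsep hz hw hne, dist_triangle_right z w (g z)]
  calc S.encard ≤ (s : Set Z).encard := encard_le_encard_of_injOn hgs hinj
    _ = s.card := encard_coe_eq_coe_finsetCard s
    _ ≤ (N ^ m : ℕ) := by exact_mod_cast hs

theorem IsDoublingWith.finite_of_isSep {N : ℕ} (hN : IsDoublingWith Z N) {a : ℝ} (ha : 0 < a)
    {S : Set Z} (hbounded : Bornology.IsBounded S) (hsep : IsSep a S) : S.Finite := by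
  rcases S.eq_empty_or_nonempty with rfl | ⟨x, -⟩
  · exact finite_empty
  obtain ⟨R, hR0, hR⟩ := hbounded.subset_ball_lt 0 x
  obtain ⟨m, hm⟩ := pow_unbounded_of_one_lt (2 * R / a) (one_lt_two (α := ℝ))
  exact finite_of_encard_le_coe (hN.encard_le hR0 ((div_lt_iff₀ ha).1 hm).le hR hsep)

theorem exists_greedy_coloring {α : Type*} {R : α → α → Prop} (hR : ∀ x y, R x y → R y x)
    {M : ℕ} {s : Set α} (hs : s.Finite) (hM : ∀ x ∈ s, {y ∈ s | R x y}.encard ≤ M) :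
    ∃ μ : α → Fin (M + 1), ∀ x ∈ s, ∀ y ∈ s, x ≠ y → R x y → μ x ≠ μ y := by
  classical
  induction s, hs using Set.Finite.induction_on with
  | empty => exact ⟨fun _ => 0, by simp⟩
  | @insert a s ha _ ih =>
    have hsub (x : α) : {y ∈ s | R x y} ⊆ {y ∈ insert a s | R x y} := fun y hy =>
      ⟨Or.inr hy.1, hy.2⟩
    obtain ⟨μ, hμ⟩ := ih fun x hx => (encard_le_encard (hsub x)).trans (hM x (Or.inr hx))
    obtain ⟨i, hi⟩ : ∃ i, i ∉ μ '' {y ∈ s | R a y} := by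
      by_contra! hcon
      have hle : (univ : Set (Fin (M + 1))).encard ≤ M :=
        calc (univ : Set (Fin (M + 1))).encard ≤ (μ '' {y ∈ s | R a y}).encard :=
              encard_le_encard fun i _ => hcon i
          _ ≤ {y ∈ s | R a y}.encard := encard_image_le _ _
          _ ≤ {y ∈ insert a s | R a y}.encard := encard_le_encard (hsub a)
          _ ≤ M := hM a (mem_insert a s)
      rw [encard_univ, ENat.card_eq_coe_fintype_card, Fintype.card_fin] at hle
      exact absurd (Nat.cast_le.1 hle) (Nat.not_succ_le_self M)
    have hnew : ∀ y ∈ s, R a y → i ≠ μ y := by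
      rintro y hy hd rfl
      exact hi ⟨y, ⟨hy, hd⟩, rfl⟩
    have hold : ∀ y ∈ s, Function.update μ a i y = μ y := fun y hy =>
      Function.update_of_ne (ne_of_mem_of_not_mem hy ha) _ _
    refine ⟨Function.update μ a i, ?_⟩
    rintro x (rfl | hx) y (rfl | hy) hne hd
    · exact absurd rfl hne
    · rw [Function.update_self, hold y hy]
      exact hnew y hy hd
    · rw [Function.update_self, hold x hx]
      exact (hnew x hx (hR _ _ hd)).symm
    · rw [hold x hx, hold y hy]
      exact hμ x hx y hy hne hd

theorem IsDoublingWith.exists_coloring_of_isSep {N : ℕ} (hN : IsDoublingWith Z N) {m : ℕ}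
    {ρ a : ℝ} (hρ : 0 < ρ) (ha : 2 * ρ ≤ 2 ^ m * a) {S : Set Z} (hS : S.Finite)
    (hsep : IsSep a S) :
    ∃ μ : Z → Fin (N ^ m + 1), ∀ x ∈ S, ∀ y ∈ S, x ≠ y → dist x y < ρ → μ x ≠ μ y :=
  exists_greedy_coloring (fun x y h => by rwa [dist_comm]) hS fun x _ =>
    hN.encard_le (x := x) hρ ha (fun y hy => by rw [Metric.mem_ball']; exact hy.2)
      (hsep.mono fun y hy => hy.1)

theorem exists_isProperColoring (hbounded : Bornology.IsBounded (univ : Set Z))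
    (hdoubling : IsDoubling Z) {r : ℝ} (hr : 0 < r) :
    ∃ N : ℕ, ∀ X : HypApprox Z r, ∃ μ : X.Vertex → Fin N, X.IsProperColoring μ := by
  obtain ⟨N, hN⟩ : ∃ N, IsDoublingWith Z N := hdoubling
  obtain ⟨m, hm⟩ := pow_unbounded_of_one_lt (4 / r ^ 2) (one_lt_two (α := ℝ))
  have hscale (k : ℤ) : 2 * (2 * r ^ (k - 2)) ≤ 2 ^ m * r ^ k := by
    have hk : r ^ k = r ^ (k - 2) * r ^ 2 := by
      rw [← zpow_natCast r 2, ← zpow_add₀ hr.ne', Nat.cast_ofNat, sub_add_cancel]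
    rw [hk]
    nlinarith [zpow_pos hr (k - 2), (div_lt_iff₀ (by positivity)).1 hm]
  refine ⟨N ^ m + 1, fun X => ?_⟩
  have hlevel : ∀ k, X.k₀ ≤ k → ∃ μ : Z → Fin (N ^ m + 1), ∀ x ∈ X.net k, ∀ y ∈ X.net k, x ≠ y →
      dist x y < 2 * r ^ (k - 2) → μ x ≠ μ y := fun k hk =>
    have hsep := (X.maximal_net k hk).prop
    hN.exists_coloring_of_isSep (by positivity) (hscale k)
      (hN.finite_of_isSep (by positivity) (hbounded.subset (subset_univ _)) hsep) hsep
  choose! μ hμ using hlevel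
  refine ⟨fun v => μ v.level v.point, fun v w hne hl hd => ?_⟩
  have hp : v.point ≠ w.point := fun h => hne (Subtype.ext (Prod.ext hl h))
  change μ v.level v.point ≠ μ w.level w.point
  rw [← hl]
  exact hμ v.level v.2.1 _ v.2.2 _ (hl ▸ w.2.2) hp hd

end Coloring

/-! ### Coverings with separated members -/

section Erosion

variable {Z : Type*} [MetricSpace Z]

/-- The points of `Z` whose distance to the complement of `U` is larger than `ε`. -/
def erosion (ε : ℝ) (U : Set Z) : Set Z := (Metric.cthickening ε Uᶜ)ᶜ

theorem isOpen_erosion (ε : ℝ) (U : Set Z) : IsOpen (erosion ε U) :=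
  Metric.isClosed_cthickening.isOpen_compl

theorem erosion_subset (ε : ℝ) (U : Set Z) : erosion ε U ⊆ U :=
  compl_subset_comm.1 (Metric.self_subset_cthickening Uᶜ)

theorem lt_dist_of_mem_erosion {ε : ℝ} {U : Set Z} {x y : Z} (hx : x ∈ erosion ε U)
    (hy : y ∉ U) : ε < dist x y := by
  by_contra! h
  exact hx (Metric.mem_cthickening_of_dist_le x y ε Uᶜ hy h)

theorem ball_subset_erosion {ε ρ : ℝ} (hε : 0 ≤ ε) {U : Set Z} {z : Z}
    (hz : ENNReal.ofReal (ε + ρ) ≤ Metric.infEDist z Uᶜ) : Metric.ball z ρ ⊆ erosion ε U := by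
  intro y hy hyU
  rw [Metric.mem_ball'] at hy
  refine hz.not_gt ?_
  calc Metric.infEDist z Uᶜ ≤ Metric.infEDist y Uᶜ + edist z y :=
        Metric.infEDist_le_infEDist_add_edist
    _ ≤ ENNReal.ofReal ε + ENNReal.ofReal (dist z y) :=
        add_le_add (Metric.mem_cthickening_iff.1 hyU) (edist_dist z y).le
    _ = ENNReal.ofReal (ε + dist z y) := (ENNReal.ofReal_add hε dist_nonneg).symm
    _ < ENNReal.ofReal (ε + ρ) :=
        (ENNReal.ofReal_lt_ofReal_iff (by linarith [dist_nonneg (x := z) (y := y)])).2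
          (by linarith)

/-- The members of `𝒲` have diameter at most `τ`, and mutual distances at least `ε`. -/
structure IsScattered (τ ε : ℝ) (𝒲 : Set (Set Z)) : Prop where
  dist_le : ∀ W ∈ 𝒲, ∀ x ∈ W, ∀ y ∈ W, dist x y ≤ τ
  le_dist : ∀ W ∈ 𝒲, ∀ W' ∈ 𝒲, W ≠ W' → ∀ x ∈ W, ∀ y ∈ W', ε ≤ dist x y

/-- A colored covering by open sets which are scattered within each color, with Lebesgue number at
least `ε`. -/
structure IsScatteredCover {C : Type*} (τ ε : ℝ) (𝒲 : C → Set (Set Z)) : Prop where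
  isOpen : ∀ c, ∀ W ∈ 𝒲 c, IsOpen W
  nonempty : ∀ c, ∀ W ∈ 𝒲 c, W.Nonempty
  isScattered : ∀ c, IsScattered τ ε (𝒲 c)
  ball_subset : ∀ z, ∃ c, ∃ W ∈ 𝒲 c, Metric.ball z ε ⊆ W

theorem IsScatteredCover.anti {C : Type*} {τ ε ε' : ℝ} {𝒲 : C → Set (Set Z)}
    (h : IsScatteredCover τ ε 𝒲) (hε : ε' ≤ ε) : IsScatteredCover τ ε' 𝒲 where
  isOpen := h.isOpen
  nonempty := h.nonempty
  isScattered c := ⟨(h.isScattered c).dist_le, fun W hW W' hW' hne x hx y hy =>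
    hε.trans ((h.isScattered c).le_dist W hW W' hW' hne x hx y hy)⟩
  ball_subset z := by
    obtain ⟨c, W, hW, hz⟩ := h.ball_subset z
    exact ⟨c, W, hW, (Metric.ball_subset_ball hε).trans hz⟩

theorem exists_infEDist_lt_of_lt_lebesgueNumber {ι : Type*} {𝒰 : ι → Set (Set Z)} {a : ℝ≥0∞}
    (ha : a < lebesgueNumber 𝒰) (z : Z) : ∃ i, ∃ U ∈ 𝒰 i, a < Metric.infEDist z Uᶜ := by
  have hz := (ha.trans_le (iInf_le _ z)).trans_le (min_le_left _ _)
  simpa only [lt_iSup_iff, exists_prop] using hz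

theorem isScatteredCover_erosion {ι C : Type*} {𝒰 : ι → Set (Set Z)} {τ ε : ℝ} (hτ : 0 ≤ τ)
    (hε : 0 < ε) (hdisj : ∀ i, (𝒰 i).PairwiseDisjoint id) (hmesh : mesh 𝒰 ≤ ENNReal.ofReal τ)
    (hleb : ENNReal.ofReal (ε + ε) < lebesgueNumber 𝒰) (e : ι ↪ C) :
    IsScatteredCover τ ε fun c =>
      {W : Set Z | W.Nonempty ∧ ∃ i, e i = c ∧ ∃ U ∈ 𝒰 i, erosion ε U = W} where
  isOpen := by
    rintro _ _ ⟨-, _, -, U, -, rfl⟩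
    exact isOpen_erosion ε U
  nonempty _ _ hW := hW.1
  isScattered c := by
    constructor
    · rintro _ ⟨-, i, -, U, hU, rfl⟩ x hx y hy
      have hxy : edist x y ≤ mesh 𝒰 :=
        (Metric.edist_le_ediam_of_mem (erosion_subset ε U hx) (erosion_subset ε U hy)).trans
          (le_iSup_of_le i (le_iSup₂_of_le U hU le_rfl))
      exact (edist_le_ofReal hτ).1 (hxy.trans hmesh)
    · rintro _ ⟨-, i, rfl, U, hU, rfl⟩ _ ⟨-, i', hi', U', hU', rfl⟩ hne x hx y hy
      obtain rfl := e.injective hi'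
      have hdUU' : Disjoint U U' := hdisj i' hU hU' (ne_of_apply_ne _ hne)
      exact (lt_dist_of_mem_erosion hx (disjoint_right.1 hdUU' (erosion_subset ε U' hy))).le
  ball_subset z := by
    obtain ⟨i, U, hU, hz⟩ := exists_infEDist_lt_of_lt_lebesgueNumber hleb z
    have hball := ball_subset_erosion hε.le hz.le
    exact ⟨e i, erosion ε U, ⟨⟨z, hball (Metric.mem_ball_self hε)⟩, i, rfl, U, hU, rfl⟩, hball⟩

/-- A color not used by the covering of the capacity dimension gets the empty family. -/
theorem exists_isScatteredCover_of_cdim_lt {C : Type*} [Fintype C]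
    (hC : cdim Z < Fintype.card C) :
    ∃ δ : ℝ, 0 < δ ∧ ∃ τ₀ : ℝ, 0 < τ₀ ∧ ∀ τ : ℝ, 0 < τ → τ < τ₀ →
      ∃ 𝒲 : C → Set (Set Z), IsScatteredCover τ (δ * τ) 𝒲 := by
  obtain ⟨m, ⟨δ, hδ, τ₀, hτ₀, h⟩, hm⟩ : ∃ m, CapacityProperty Z m ∧ m < Fintype.card C := by
    simpa only [cdim, iInf_lt_iff, exists_prop, Nat.cast_lt, mem_ofPred_eq] using hC
  obtain ⟨e⟩ : Nonempty (Fin (m + 1) ↪ C) :=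
    Function.Embedding.nonempty_of_card_le (by rw [Fintype.card_fin]; exact hm)
  refine ⟨δ / 3, by positivity, τ₀, hτ₀, fun τ hτ hττ₀ => ?_⟩
  obtain ⟨𝒰, hcov, hmesh, hleb⟩ := h τ hτ hττ₀
  have hlt : ENNReal.ofReal (δ / 3 * τ + δ / 3 * τ) < lebesgueNumber 𝒰 :=
    ((ENNReal.ofReal_lt_ofReal_iff (by positivity)).2 (by nlinarith [mul_pos hδ hτ])).trans_le hleb
  exact ⟨_, isScatteredCover_erosion hτ.le (by positivity) hcov.disjoint hmesh hlt e⟩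

end Erosion

/-! ### Existence of adapted coverings -/

section Saturation

variable {Z : Type*} [MetricSpace Z]

theorem IsScattered.dist_lt_of_mem_thickening {τ ε a : ℝ} {𝒲 : Set (Set Z)}
    (h : IsScattered τ ε 𝒲) {W : Set Z} (hW : W ∈ 𝒲) {x y : Z} (hx : x ∈ Metric.thickening a W)
    (hy : y ∈ Metric.thickening a W) : dist x y < τ + 2 * a := by
  obtain ⟨x', hx', hxx'⟩ := Metric.mem_thickening_iff.1 hx
  obtain ⟨y', hy', hyy'⟩ := Metric.mem_thickening_iff.1 hy
  rw [dist_comm y y'] at hyy'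
  linarith [h.dist_le W hW x' hx' y' hy', dist_triangle4 x x' y' y]

theorem IsScattered.lt_dist_of_mem_thickening {τ ε a b : ℝ} {𝒲 : Set (Set Z)}
    (h : IsScattered τ ε 𝒲) {W W' : Set Z} (hW : W ∈ 𝒲) (hW' : W' ∈ 𝒲) (hne : W ≠ W') {x y : Z}
    (hx : x ∈ Metric.thickening a W) (hy : y ∈ Metric.thickening b W') :
    ε - (a + b) < dist x y := by
  obtain ⟨x', hx', hxx'⟩ := Metric.mem_thickening_iff.1 hx
  obtain ⟨y', hy', hyy'⟩ := Metric.mem_thickening_iff.1 hy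
  rw [dist_comm x x'] at hxx'
  linarith [dist_triangle4 x' x y y', h.le_dist W hW W' hW' hne x' hx' y' hy']

/-- `x` and `y` lie in the neighborhood of one member of a level in `(j, J]`. -/
def Linked (r : ℝ) (𝒲 : ℕ → Set (Set Z)) (j J : ℕ) (x y : Z) : Prop :=
  ∃ i, j < i ∧ i ≤ J ∧ ∃ W ∈ 𝒲 i, x ∈ Metric.thickening (5 * r ^ (i + 1)) W ∧
    y ∈ Metric.thickening (5 * r ^ (i + 1)) W

/-- `x` and `y` are joined by a chain of overlapping neighborhoods of members of levels
in `(j, J]`. -/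
abbrev Chained (r : ℝ) (𝒲 : ℕ → Set (Set Z)) (j J : ℕ) : Z → Z → Prop :=
  Relation.ReflTransGen (Linked r 𝒲 j J)

/-- The union of `W` with all chains of members of the levels above `j` which start in `W`. -/
def saturation (r : ℝ) (𝒲 : ℕ → Set (Set Z)) (j : ℕ) (W : Set Z) : Set Z :=
  {y | ∃ x ∈ W, ∃ J, Chained r 𝒲 j J x y}

variable {r : ℝ} {𝒲 : ℕ → Set (Set Z)}

theorem subset_saturation (j : ℕ) (W : Set Z) : W ⊆ saturation r 𝒲 j W := fun x hx =>
  ⟨x, hx, 0, .refl⟩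

theorem Chained.mono {j J J' : ℕ} (hJ : J ≤ J') {x y : Z} (h : Chained r 𝒲 j J x y) :
    Chained r 𝒲 j J' x y :=
  Relation.ReflTransGen.mono (fun _ _ ⟨i, hji, hiJ, hW⟩ => ⟨i, hji, hiJ.trans hJ, hW⟩) _ _ h

theorem Chained.eq_of_le {j J : ℕ} (hJ : J ≤ j) {x y : Z} (h : Chained r 𝒲 j J x y) : x = y := by
  rcases Relation.ReflTransGen.cases_tail h with rfl | ⟨_, _, i, hji, hiJ, -⟩
  · rfl
  · omega

theorem isOpen_saturation {j : ℕ} {W : Set Z} (hW : IsOpen W) :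
    IsOpen (saturation r 𝒲 j W) := by
  rw [isOpen_iff_mem_nhds]
  rintro y ⟨x, hx, J, hJ⟩
  rcases Relation.ReflTransGen.cases_tail hJ with rfl | ⟨z, hxz, i, hji, hiJ, V, hV, hz, hy⟩
  · exact Filter.mem_of_superset (hW.mem_nhds hx) (subset_saturation j W)
  · exact Filter.mem_of_superset (Metric.isOpen_thickening.mem_nhds hy)
      fun a ha => ⟨x, hx, J, hxz.tail ⟨i, hji, hiJ, V, hV, hz, ha⟩⟩

/-- Families of sets, scattered at geometrically decreasing scales. There is no bound for the
diameters at level `0`, where the whole space is the only member. -/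
structure IsScatteredSequence (r : ℝ) (τ : ℕ → ℝ) (𝒲 : ℕ → Set (Set Z)) : Prop where
  r_pos : 0 < r
  r_le : r ≤ 1 / 24
  τ_le : ∀ j, 1 ≤ j → τ j ≤ r ^ j / 2
  isScattered : ∀ j, IsScattered (τ j) (11 * r ^ (j + 1)) (𝒲 j)

namespace IsScatteredSequence

variable {τ : ℕ → ℝ}

/-- As chains of the levels above `j + 1` are short, they cannot join the neighborhoods of two
members of level `j + 1`. So a chain visits at most one of these neighborhoods. -/
theorem chained_succ_or (h : IsScatteredSequence r τ 𝒲) {j J : ℕ}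
    (hshort : ∀ x y : Z, Chained r 𝒲 (j + 1) J x y → dist x y ≤ r ^ (j + 2)) {x y : Z}
    (hxy : Chained r 𝒲 j J x y) :
    Chained r 𝒲 (j + 1) J x y ∨
      ∃ W ∈ 𝒲 (j + 1), ∃ x' ∈ Metric.thickening (5 * r ^ (j + 2)) W,
        ∃ y' ∈ Metric.thickening (5 * r ^ (j + 2)) W,
          Chained r 𝒲 (j + 1) J x x' ∧ Chained r 𝒲 (j + 1) J y' y := by
  induction hxy with
  | refl => exact Or.inl .refl
  | @tail y z _ hyz ih =>
    obtain ⟨i, hji, hiJ, W, hW, hy, hz⟩ := hyz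
    rcases (show j + 1 ≤ i from hji).eq_or_lt with rfl | hlt
    · right
      rcases ih with hxy | ⟨W', hW', x', hx', y', hy', hxx', hyy'⟩
      · exact ⟨W, hW, y, hy, z, hz, hxy, .refl⟩
      · obtain rfl : W' = W := by
          by_contra hne
          have hlow := (h.isScattered (j + 1)).lt_dist_of_mem_thickening hW' hW hne hy' hy
          have hup := hshort y' y hyy'
          linarith
        exact ⟨W', hW, x', hx', z, hz, hxx', .refl⟩
    · have hlink : Linked r 𝒲 (j + 1) J y z := ⟨i, hlt, hiJ, W, hW, hy, hz⟩
      exact ih.imp (·.tail hlink) fun ⟨W', hW', x', hx', y', hy', hxx', hyy'⟩ =>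
        ⟨W', hW', x', hx', y', hy', hxx', hyy'.tail hlink⟩

theorem dist_le_of_chained (h : IsScatteredSequence r τ 𝒲) {j J : ℕ} {x y : Z}
    (hxy : Chained r 𝒲 j J x y) : dist x y ≤ r ^ (j + 1) := by
  have hr := h.r_pos
  have hr24 := h.r_le
  have hpos : 0 < r ^ (j + 1) := by positivity
  rcases le_or_gt J j with hJ | _
  · rw [hxy.eq_of_le hJ, dist_self]
    exact hpos.le
  have hshort (x y : Z) (hxy : Chained r 𝒲 (j + 1) J x y) : dist x y ≤ r ^ (j + 2) :=
    h.dist_le_of_chained hxy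
  have hpow : r ^ (j + 2) = r * r ^ (j + 1) := pow_succ' _ _
  rcases h.chained_succ_or hshort hxy with hxy' | ⟨W, hW, x', hx', y', hy', hxx', hyy'⟩
  · have := hshort x y hxy'
    nlinarith
  · have hmid := (h.isScattered (j + 1)).dist_lt_of_mem_thickening hW hx' hy'
    have hτ := h.τ_le (j + 1) (Nat.le_add_left 1 j)
    have := dist_triangle4 x x' y' y
    nlinarith [hshort x x' hxx', hshort y' y hyy']
termination_by J - j

theorem exists_dist_le_of_mem_saturation (h : IsScatteredSequence r τ 𝒲) {j : ℕ} {W : Set Z}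
    {y : Z} (hy : y ∈ saturation r 𝒲 j W) : ∃ x ∈ W, dist x y ≤ r ^ (j + 1) := by
  obtain ⟨x, hx, J, hJ⟩ := hy
  exact ⟨x, hx, h.dist_le_of_chained hJ⟩

theorem mem_thickening_of_near_saturation (h : IsScatteredSequence r τ 𝒲) {j : ℕ} {W : Set Z}
    {p y : Z} (hy : y ∈ saturation r 𝒲 j W) (hpy : dist p y < 4 * r ^ (j + 1)) :
    p ∈ Metric.thickening (5 * r ^ (j + 1)) W := by
  obtain ⟨x, hx, hxy⟩ := h.exists_dist_le_of_mem_saturation hy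
  rw [dist_comm] at hxy
  exact Metric.mem_thickening_iff.2 ⟨x, hx, by linarith [dist_triangle p y x]⟩

theorem thickening_disjoint_saturation (h : IsScatteredSequence r τ 𝒲) {j : ℕ} {W W' : Set Z}
    (hW : W ∈ 𝒲 j) (hW' : W' ∈ 𝒲 j) (hne : W ≠ W') :
    Disjoint (Metric.thickening (5 * r ^ (j + 1)) W) (saturation r 𝒲 j W') := by
  have hpos : 0 < r ^ (j + 1) := pow_pos h.r_pos _
  refine disjoint_left.2 fun p hpW hpW' => ?_
  have hp := h.mem_thickening_of_near_saturation hpW' (p := p) (by rw [dist_self]; positivity)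
  have := (h.isScattered j).lt_dist_of_mem_thickening hW hW' hne hpW hp
  rw [dist_self] at this
  linarith

theorem saturation_disjoint (h : IsScatteredSequence r τ 𝒲) {j : ℕ} {W W' : Set Z}
    (hW : W ∈ 𝒲 j) (hW' : W' ∈ 𝒲 j) (hne : W ≠ W') :
    Disjoint (saturation r 𝒲 j W) (saturation r 𝒲 j W') :=
  have hpos : 0 < r ^ (j + 1) := pow_pos h.r_pos _
  (h.thickening_disjoint_saturation hW hW' hne).mono_left fun p hp =>
    h.mem_thickening_of_near_saturation hp (by rw [dist_self]; positivity)

/-- Any two points near the saturation of `W` are linked at level `j`, and a saturation of a lower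
level contains with a point all points linked to it. -/
theorem subset_saturation_or_inter_eq_empty (h : IsScatteredSequence r τ 𝒲) {j j' : ℕ}
    (hjj : j' ≤ j) {W W' : Set Z} (hW : W ∈ 𝒲 j) (hW' : W' ∈ 𝒲 j') (hne : (j, W) ≠ (j', W'))
    {G : Set Z} (hG : ∀ p ∈ G, ∃ y ∈ saturation r 𝒲 j W, dist p y < 4 * r ^ (j + 1)) :
    G ⊆ saturation r 𝒲 j' W' ∨ G ∩ saturation r 𝒲 j' W' = ∅ := by
  have hGW : G ⊆ Metric.thickening (5 * r ^ (j + 1)) W := fun p hp =>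
    let ⟨_, hy, hpy⟩ := hG p hp
    h.mem_thickening_of_near_saturation hy hpy
  rcases hjj.lt_or_eq with hlt | rfl
  · refine (G ∩ saturation r 𝒲 j' W').eq_empty_or_nonempty.symm.imp_left ?_
    rintro ⟨p, hp, x, hx, J, hJ⟩ p' hp'
    exact ⟨x, hx, max J j, (hJ.mono (le_max_left _ _)).tail
      ⟨j, hlt, le_max_right _ _, W, hW, hGW hp, hGW hp'⟩⟩
  · have hWW' : W ≠ W' := fun heq => hne (by rw [heq])
    exact Or.inr (disjoint_iff_inter_eq_empty.1
      ((h.thickening_disjoint_saturation hW hW' hWW').mono_left hGW))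

theorem ediam_saturation_le (h : IsScatteredSequence r τ 𝒲) {j : ℕ} (hj : 1 ≤ j) {W : Set Z}
    (hW : W ∈ 𝒲 j) : Metric.ediam (saturation r 𝒲 j W) ≤ ENNReal.ofReal (3 / 4 * r ^ j) := by
  refine Metric.ediam_le fun x hx y hy => ?_
  rw [edist_dist]
  refine ENNReal.ofReal_le_ofReal ?_
  obtain ⟨a, ha, hax⟩ := h.exists_dist_le_of_mem_saturation hx
  obtain ⟨b, hb, hby⟩ := h.exists_dist_le_of_mem_saturation hy
  have hab := (h.isScattered j).dist_le W hW a ha b hb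
  have hpow : r ^ (j + 1) ≤ 1 / 24 * r ^ j := by
    rw [pow_succ']
    exact mul_le_mul_of_nonneg_right h.r_le (pow_nonneg h.r_pos.le j)
  rw [dist_comm] at hax
  linarith [h.τ_le j hj, dist_triangle4 x a b y, pow_pos h.r_pos j]

end IsScatteredSequence

end Saturation

section ExistsAdapted

variable {Z : Type*} [MetricSpace Z]

theorem HypApprox.exists_dist_lt_of_mem_hull {r : ℝ} (X : HypApprox Z r) {j : ℕ} {U : Set Z}
    {p : Z} (hp : p ∈ X.hull j U) : ∃ y ∈ U, dist p y < 4 * r ^ (j + 1) := by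
  obtain ⟨v, ⟨hv, y, hyv, hyU⟩, hpv⟩ := mem_iUnion₂.1 hp
  have hpow : r ^ ((j : ℤ) + 1) = r ^ (j + 1) := by exact_mod_cast zpow_natCast r (j + 1)
  rw [Vertex.ball, hv, hpow, Metric.mem_ball] at hpv hyv
  exact ⟨y, hyU, by linarith [dist_triangle_right p y v.point]⟩

theorem isColoredOpenCover_saturation {C : Type*} {r : ℝ} {τ : ℕ → ℝ} {𝒲 : ℕ → C → Set (Set Z)}
    (hseq : ∀ c, IsScatteredSequence r τ fun j => 𝒲 j c) {j : ℕ}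
    (hcov : IsScatteredCover (τ j) (11 * r ^ (j + 1)) (𝒲 j)) :
    IsColoredOpenCover fun c => saturation r (fun i => 𝒲 i c) j '' 𝒲 j c := by
  refine ⟨?_, ?_, eq_univ_of_forall fun z => ?_⟩
  · rintro c _ ⟨W, hW, rfl⟩
    exact isOpen_saturation (hcov.isOpen c W hW)
  · rintro c _ ⟨W, hW, rfl⟩ _ ⟨W', hW', rfl⟩ hne
    exact (hseq c).saturation_disjoint hW hW' (ne_of_apply_ne _ hne)
  · obtain ⟨c, W, hW, hz⟩ := hcov.ball_subset z
    have hpos : 0 < r ^ (j + 1) := pow_pos (hseq c).r_pos _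
    exact mem_iUnion.2 ⟨c, _, mem_image_of_mem _ hW,
      subset_saturation j W (hz (Metric.mem_ball_self (by positivity)))⟩

theorem isAdapted_saturation {C : Type*} {r : ℝ} {X : HypApprox Z r} {τ : ℕ → ℝ}
    {𝒲 : ℕ → C → Set (Set Z)}
    (hr : r < min (Metric.diam (univ : Set Z)) (1 / Metric.diam (univ : Set Z)))
    (hzero : ∀ c, 𝒲 0 c = {univ}) (hseq : ∀ c, IsScatteredSequence r τ fun j => 𝒲 j c)
    (hcov : ∀ j, IsScatteredCover (τ j) (11 * r ^ (j + 1)) (𝒲 j)) :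
    IsAdapted X fun j c => saturation r (fun i => 𝒲 i c) j '' 𝒲 j c where
  r_lt := hr
  isCover j := isColoredOpenCover_saturation hseq (hcov j)
  nonempty := by
    rintro j c _ ⟨W, hW, rfl⟩
    exact ((hcov j).nonempty c W hW).mono (subset_saturation j W)
  zero c := by
    rw [hzero, image_singleton]
    exact congrArg _ (univ_subset_iff.1 (subset_saturation 0 univ))
  mesh_lt j hj := by
    have hpos : 0 < r ^ j := pow_pos X.r_pos _
    refine lt_of_le_of_lt (b := ENNReal.ofReal (3 / 4 * r ^ j)) ?_
      ((ENNReal.ofReal_lt_ofReal_iff hpos).2 (by linarith))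
    refine iSup_le fun c => iSup₂_le ?_
    rintro _ ⟨W, hW, rfl⟩
    exact (hseq c).ediam_saturation_le hj hW
  ball_subset j v hv := by
    obtain ⟨c, W, hW, hz⟩ := (hcov j).ball_subset v.point
    refine ⟨c, _, mem_image_of_mem _ hW, ?_⟩
    have hpow : r ^ v.level = r ^ (j + 1) := by rw [hv]; exact_mod_cast zpow_natCast r (j + 1)
    have hpos : 0 < r ^ (j + 1) := pow_pos X.r_pos _
    rw [HypApprox.Vertex.ball, hpow]
    exact (Metric.ball_subset_ball (by linarith)).trans (hz.trans (subset_saturation j W))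
  separation := by
    rintro c j j' _ _ ⟨W, hW, rfl⟩ ⟨W', hW', rfl⟩ hjj hne
    refine (hseq c).subset_saturation_or_inter_eq_empty hjj hW hW' (fun heq => hne ?_)
      fun p hp => X.exists_dist_lt_of_mem_hull hp
    obtain ⟨rfl, rfl⟩ := Prod.mk.inj heq
    rfl

theorem isScatteredCover_univ {C : Type*} [Nonempty C] [Nonempty Z] {τ : ℝ}
    (hτ : ∀ x y : Z, dist x y ≤ τ) (ε : ℝ) :
    IsScatteredCover τ ε fun _ : C => {(univ : Set Z)} where
  isOpen := by
    rintro _ _ rfl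
    exact isOpen_univ
  nonempty := by
    rintro _ _ rfl
    exact univ_nonempty
  isScattered _ := ⟨fun _ _ x _ y _ => hτ x y, fun _ hW _ hW' hne => absurd (hW.trans hW'.symm) hne⟩
  ball_subset _ := ⟨Classical.arbitrary C, univ, rfl, subset_univ _⟩

theorem exists_isAdapted_of_cdim_lt {C : Type*} [Fintype C] (hC : cdim Z < Fintype.card C)
    (hbounded : Bornology.IsBounded (univ : Set Z)) (hD : 0 < Metric.diam (univ : Set Z)) :
    ∃ r₀ : ℝ, 0 < r₀ ∧ ∀ r : ℝ, 0 < r → r < r₀ →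
      ∃ 𝒰 : ℕ → C → Set (Set Z), ∀ X : HypApprox Z r, IsAdapted X 𝒰 := by
  have hCne : Nonempty C := Fintype.card_pos_iff.1 (by exact_mod_cast pos_of_gt hC)
  have hZne : Nonempty Z := by
    by_contra hempty
    rw [not_nonempty_iff] at hempty
    exact hD.ne' (Metric.diam_subsingleton (subsingleton_of_subsingleton))
  obtain ⟨δ, hδ, τ₀, hτ₀, h⟩ := exists_isScatteredCover_of_cdim_lt hC
  refine ⟨min (min (Metric.diam (univ : Set Z)) (1 / Metric.diam (univ : Set Z)))
    (min (min (1 / 24) τ₀) (δ / 22)), by positivity, fun r hr hr0 => ?_⟩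
  obtain ⟨hrD, hr1, hrδ⟩ := (lt_min_iff.1 hr0).imp_right lt_min_iff.1
  obtain ⟨hr24, hrτ⟩ := lt_min_iff.1 hr1
  let τ : ℕ → ℝ := fun j => if j = 0 then Metric.diam (univ : Set Z) else r ^ j / 2
  have hlevel (j : ℕ) : ∃ 𝒲 : C → Set (Set Z), (j = 0 → ∀ c, 𝒲 c = {univ}) ∧
      IsScatteredCover (τ j) (11 * r ^ (j + 1)) 𝒲 := by
    rcases eq_or_ne j 0 with rfl | hj
    · exact ⟨fun _ => {univ}, fun _ _ => rfl, isScatteredCover_univ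
        (fun x y => Metric.dist_le_diam_of_mem hbounded (mem_univ x) (mem_univ y)) _⟩
    · have hpos : 0 < r ^ j := pow_pos hr j
      have hle : r ^ j ≤ r := pow_le_of_le_one hr.le (by linarith) hj
      obtain ⟨𝒲, h𝒲⟩ := h (r ^ j / 2) (by positivity) (by linarith)
      refine ⟨𝒲, fun h0 => absurd h0 hj, ?_⟩
      rw [show τ j = r ^ j / 2 from if_neg hj]
      exact h𝒲.anti (by rw [pow_succ']; nlinarith)
  choose 𝒲 hzero hcov using hlevel
  refine ⟨_, fun X => isAdapted_saturation hrD (hzero 0 rfl) (fun c => ?_) hcov⟩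
  exact ⟨hr, hr24.le, fun j hj => (if_neg (by omega) : τ j = r ^ j / 2).le,
    fun j => (hcov j).isScattered c⟩

end ExistsAdapted

/-! ### Geometry of hyperbolic approximations -/

theorem exists_mem_dist_lt_of_maximal_isSep {Z : Type*} [MetricSpace Z] {a : ℝ} (ha : 0 < a)
    {S : Set Z} (hS : Maximal (IsSep a) S) (z : Z) : ∃ x ∈ S, dist z x < a := by
  by_contra! hfar
  have hsep : IsSep a (insert z S) :=
    hS.prop.insert fun x hx _ => ⟨hfar x hx, dist_comm z x ▸ hfar x hx⟩
  have hz : z ∈ S := hS.le_of_ge hsep (subset_insert _ _) (mem_insert _ _)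
  exact (hfar z hz).not_gt (by rwa [dist_self])

namespace HypApprox

variable {Z : Type*} [MetricSpace Z] {r : ℝ} {X : HypApprox Z r}

theorem zpow_anti (X : HypApprox Z r) {a b : ℤ} (h : a ≤ b) : r ^ b ≤ r ^ a :=
  zpow_le_zpow_right_of_le_one₀ X.r_pos (by linarith [X.r_le]) h

theorem zpow_add_one_le (X : HypApprox Z r) (k : ℤ) : 6 * r ^ (k + 1) ≤ r ^ k := by
  rw [zpow_add_one₀ X.r_pos.ne']
  nlinarith [zpow_pos X.r_pos k, X.r_le]

/-- If `diam Z` were `0`, which is also its junk value for unbounded `Z`, then every integer `k`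
would satisfy `diam Z < r ^ k`, and there would be no largest one. -/
theorem diam_pos (X : HypApprox Z r) : 0 < Metric.diam (univ : Set Z) := by
  refine Metric.diam_nonneg.lt_of_ne' fun h0 => ?_
  have hmem : X.k₀ + 1 ∈ {k : ℤ | Metric.diam (univ : Set Z) < r ^ k} :=
    h0.trans_lt (zpow_pos X.r_pos _)
  exact (lt_add_one X.k₀).not_ge (X.isGreatest_k₀.2 hmem)

theorem isBounded (X : HypApprox Z r) : Bornology.IsBounded (univ : Set Z) := by
  by_contra hunb
  exact X.diam_pos.ne' (Metric.diam_eq_zero_of_unbounded hunb)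

theorem nonempty (X : HypApprox Z r) : Nonempty Z := by
  by_contra hempty
  rw [not_nonempty_iff] at hempty
  exact X.diam_pos.ne' (Metric.diam_subsingleton subsingleton_of_subsingleton)

theorem exists_dist_lt (X : HypApprox Z r) (z : Z) (k : ℤ) (hk : X.k₀ ≤ k) :
    ∃ v : X.Vertex, v.level = k ∧ dist z v.point < r ^ k := by
  obtain ⟨x, hx, hzx⟩ :=
    exists_mem_dist_lt_of_maximal_isSep (zpow_pos X.r_pos k) (X.maximal_net k hk) z
  exact ⟨⟨(k, x), hk, hx⟩, rfl, hzx⟩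

theorem Vertex.point_mem_ball (v : X.Vertex) : v.point ∈ v.ball :=
  Metric.mem_ball_self (mul_pos two_pos (zpow_pos X.r_pos v.level))

theorem ball_subset_ball {v u : X.Vertex} (hl : v.level = u.level + 1)
    (hd : dist v.point u.point ≤ r ^ u.level + 4 * r ^ v.level) : v.ball ⊆ u.ball := by
  have h6 := X.zpow_add_one_le u.level
  refine Metric.ball_subset_ball' ?_
  rw [hl] at hd ⊢
  linarith

theorem exists_ball_subset (v : X.Vertex) (k : ℤ) (hk : X.k₀ ≤ k) (hv : v.level = k + 1) :
    ∃ u : X.Vertex, u.level = k ∧ dist v.point u.point < r ^ k ∧ v.ball ⊆ u.ball := by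
  obtain ⟨u, rfl, hd⟩ := X.exists_dist_lt v.point k hk
  have hpos := zpow_pos X.r_pos v.level
  exact ⟨u, rfl, hd, ball_subset_ball hv (by linarith)⟩

theorem exists_ball_subset_of_closedBall_inter (v w : X.Vertex) (k : ℤ) (hk : X.k₀ ≤ k)
    (hv : v.level = k + 1) (hw : w.level = k + 1) (h : (v.closedBall ∩ w.closedBall).Nonempty) :
    ∃ u : X.Vertex, u.level = k ∧ v.ball ⊆ u.ball ∧ w.ball ⊆ u.ball := by
  obtain ⟨u, rfl, hd, hvu⟩ := exists_ball_subset v k hk hv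
  obtain ⟨z, hzv, hzw⟩ := h
  rw [Vertex.closedBall, Metric.mem_closedBall, hv, ← hw] at hzv
  rw [Vertex.closedBall, Metric.mem_closedBall, dist_comm] at hzw
  have htri := dist_triangle4 w.point z v.point u.point
  exact ⟨u, rfl, hvu, ball_subset_ball hw (by linarith)⟩

theorem adj_of_ball_subset {v u : X.Vertex} (hl : v.level = u.level + 1) (hb : v.ball ⊆ u.ball) :
    X.graph.Adj v u :=
  ⟨by rintro rfl; omega, Or.inr (Or.inr ⟨hl, hb⟩)⟩

theorem exists_walk_lower (v : X.Vertex) (j : ℤ) (hj : X.k₀ ≤ j) (hjv : j ≤ v.level) :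
    ∃ w : X.Vertex, w.level = j ∧ v.ball ⊆ w.ball ∧ dist v.point w.point ≤ 6 / 5 * r ^ j ∧
      ∃ p : X.graph.Walk v w, (p.length : ℤ) = v.level - j := by
  induction j, hjv using Int.leInductionDown with
  | base =>
    have hpos := zpow_pos X.r_pos v.level
    exact ⟨v, rfl, subset_rfl, by rw [dist_self]; positivity, .nil, by simp⟩
  | pred j _ ih =>
    obtain ⟨u, hu, hvu, hd, p, hp⟩ := ih (by omega)
    obtain ⟨w, hw, hd', huw⟩ := exists_ball_subset u (j - 1) hj (by omega)
    have h6 := X.zpow_add_one_le (j - 1)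
    rw [sub_add_cancel] at h6
    refine ⟨w, hw, hvu.trans huw, by linarith [dist_triangle v.point u.point w.point],
      p.concat (adj_of_ball_subset (by omega) huw), ?_⟩
    rw [SimpleGraph.Walk.length_concat]
    push_cast
    omega

theorem eq_of_level_eq_k₀ {v w : X.Vertex} (hv : v.level = X.k₀) (hw : w.level = X.k₀) :
    v = w := by
  have hp : v.point = w.point := by
    by_contra hne
    have h1 : r ^ X.k₀ ≤ dist v.point w.point :=
      (X.maximal_net X.k₀ le_rfl).prop (hv ▸ v.2.2) (hw ▸ w.2.2) hne
    have h2 := Metric.dist_le_diam_of_mem X.isBounded (mem_univ v.point) (mem_univ w.point)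
    exact (h1.trans h2).not_gt X.isGreatest_k₀.1
  exact Subtype.ext (Prod.ext (hv.trans hw.symm) hp)

theorem graph_connected (X : HypApprox Z r) : X.graph.Connected := by
  obtain ⟨z⟩ := X.nonempty
  obtain ⟨v₀, hv₀, -⟩ := X.exists_dist_lt z X.k₀ le_rfl
  refine (SimpleGraph.connected_iff_exists_forall_reachable _).2 ⟨v₀, fun v => ?_⟩
  obtain ⟨w, hw, -, -, p, -⟩ := exists_walk_lower v X.k₀ le_rfl v.2.1
  obtain rfl := eq_of_level_eq_k₀ hw hv₀
  exact p.reachable.symm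

theorem dist_le_one_of_level_eq {u u' : X.Vertex} (hl : u.level = u'.level)
    (h : (u.closedBall ∩ u'.closedBall).Nonempty) : X.graph.dist u u' ≤ 1 := by
  by_cases hne : u = u'
  · simp [hne]
  · have hadj : X.graph.Adj u u' := ⟨hne, Or.inl ⟨hl, h⟩⟩
    exact (SimpleGraph.dist_eq_one_iff_adj.2 hadj).le

theorem dist_le_of_dist_point_le (v v' : X.Vertex) (l : ℤ) (hl : X.k₀ ≤ l) (hlv : l ≤ v.level)
    (hlv' : l ≤ v'.level) (hd : dist v.point v'.point ≤ 5 / 3 * r ^ l) :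
    (X.graph.dist v v' : ℤ) ≤ v.level + v'.level - 2 * l + 3 := by
  rcases hl.eq_or_lt with rfl | hl
  · obtain ⟨w, hw, -, -, p, hp⟩ := exists_walk_lower v X.k₀ le_rfl hlv
    obtain ⟨w', hw', -, -, p', hp'⟩ := exists_walk_lower v' X.k₀ le_rfl hlv'
    obtain rfl := eq_of_level_eq_k₀ hw hw'
    have hle := SimpleGraph.dist_le (p.append p'.reverse)
    rw [SimpleGraph.Walk.length_append, SimpleGraph.Walk.length_reverse] at hle
    omega
  · obtain ⟨u, hu, -, hdu, p, hp⟩ := exists_walk_lower v (l - 1) (by omega) (by omega)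
    obtain ⟨u', hu', hb', -, p', hp'⟩ := exists_walk_lower v' (l - 1) (by omega) (by omega)
    have hv'u : v'.point ∈ u.closedBall := by
      have h6 := X.zpow_add_one_le (l - 1)
      rw [sub_add_cancel] at h6
      have htri := dist_triangle_left v'.point u.point v.point
      have hpos := zpow_pos X.r_pos (l - 1)
      rw [Vertex.closedBall, Metric.mem_closedBall, hu]
      linarith
    have hmid := dist_le_one_of_level_eq (hu.trans hu'.symm)
      ⟨_, hv'u, Metric.ball_subset_closedBall (hb' v'.point_mem_ball)⟩
    have h1 := SimpleGraph.dist_le p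
    have h2 := SimpleGraph.dist_le p'.reverse
    rw [SimpleGraph.Walk.length_reverse] at h2
    have t1 := X.graph_connected.dist_triangle (u := v) (v := u) (w := v')
    have t2 := X.graph_connected.dist_triangle (u := u) (v := u') (w := v')
    omega

end HypApprox

/-! ### Colored trees and their sentences -/

namespace TreeVertex

variable {Z C : Type*} {𝒰 : ℕ → C → Set (Set Z)} {c : C}

/-- The vertex `W` lies on the path from the root to `U`: it is `U` itself or an ancestor of `U`. -/
def Above (W U : TreeVertex 𝒰 c) : Prop := W = U ∨ IsAncestor W U

/-- The vertex `T` is the last common vertex of the paths from the root to `U` and to `U'`. -/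
def IsMeet (T U U' : TreeVertex 𝒰 c) : Prop :=
  Above T U ∧ Above T U' ∧ ∀ W, Above W U → Above W U' → Above W T

theorem IsMeet.symm {T U U' : TreeVertex 𝒰 c} (h : IsMeet T U U') : IsMeet T U' U :=
  ⟨h.2.1, h.1, fun W hW hW' => h.2.2 W hW' hW⟩

theorem Above.refl (U : TreeVertex 𝒰 c) : Above U U := Or.inl rfl

theorem Above.subset {W U : TreeVertex 𝒰 c} (h : Above W U) : U.carrier ⊆ W.carrier := by
  rcases h with rfl | h
  exacts [subset_rfl, h.2]

theorem Above.index_le {W U : TreeVertex 𝒰 c} (h : Above W U) : W.index ≤ U.index := by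
  rcases h with rfl | h
  exacts [le_rfl, h.1.le]

theorem Above.trans {W U T : TreeVertex 𝒰 c} (h : Above W U) (h' : Above U T) : Above W T := by
  rcases h with rfl | h
  exacts [h', Or.inr ⟨h.1.trans_le h'.index_le, h'.subset.trans h.2⟩]

theorem level_of_index_ne_zero {k₀ : ℤ} {U : TreeVertex 𝒰 c} (h : U.index ≠ 0) :
    U.level k₀ = U.index :=
  if_neg h

theorem level_of_index_eq_zero {k₀ : ℤ} {U : TreeVertex 𝒰 c} (h : U.index = 0) :
    U.level k₀ = k₀ :=
  if_pos h

end TreeVertex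

open TreeVertex

namespace IsAdapted

variable {Z C : Type*} [MetricSpace Z] {r : ℝ} {X : HypApprox Z r} {𝒰 : ℕ → C → Set (Set Z)}
  {F : Type*} {c : C}

theorem level_lt_level (h : IsAdapted X 𝒰) {W U : TreeVertex 𝒰 c} (hWU : W.index < U.index) :
    W.level X.k₀ < U.level X.k₀ := by
  have hk := h.k₀_nonpos
  rw [level_of_index_ne_zero (by omega : U.index ≠ 0)]
  unfold TreeVertex.level
  split_ifs <;> omega

theorem carrier_nonempty (h : IsAdapted X 𝒰) (U : TreeVertex 𝒰 c) : U.carrier.Nonempty :=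
  h.nonempty _ _ _ U.2

theorem subset_hull (h : IsAdapted X 𝒰) (j : ℕ) (U : Set Z) : U ⊆ X.hull j U := by
  intro z hz
  obtain ⟨v, hv, hzv⟩ := X.exists_mem_ball z ((j : ℤ) + 1) (by have := h.k₀_nonpos; omega)
  exact mem_iUnion₂.2 ⟨v, ⟨hv, z, hzv, hz⟩, hzv⟩

theorem hull_subset_of_mem (h : IsAdapted X 𝒰) {W U : TreeVertex 𝒰 c} {z : Z}
    (hW : z ∈ W.carrier) (hU : z ∈ U.carrier) (hle : W.index ≤ U.index) (hne : W ≠ U) :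
    X.hull U.index U.carrier ⊆ W.carrier := by
  refine (h.separation c U.index W.index _ _ U.2 W.2 hle
    fun heq => hne (Subtype.ext heq.symm)).resolve_right fun hempty => ?_
  exact eq_empty_iff_forall_notMem.1 hempty z ⟨h.subset_hull _ _ hU, hW⟩

theorem ball_subset_of_isAncestor (h : IsAdapted X 𝒰) {W U : TreeVertex 𝒰 c}
    (hWU : IsAncestor W U) {w : X.Vertex} (hw : w.level = (U.index : ℤ) + 1)
    (hmeet : (w.ball ∩ U.carrier).Nonempty) : w.ball ⊆ W.carrier := by
  obtain ⟨z, hz⟩ := h.carrier_nonempty U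
  exact (subset_iUnion₂_of_subset w ⟨hw, hmeet⟩ subset_rfl).trans
    (h.hull_subset_of_mem (hWU.2 hz) hz hWU.1.le (ne_of_apply_ne _ hWU.1.ne))

theorem above_of_mem (h : IsAdapted X 𝒰) {W U : TreeVertex 𝒰 c} {z : Z} (hW : z ∈ W.carrier)
    (hU : z ∈ U.carrier) (hle : W.index ≤ U.index) : Above W U := by
  refine or_iff_not_imp_left.2 fun hne => ⟨hle.lt_of_ne fun hi => ?_, ?_⟩
  · have hc : W.carrier ≠ U.carrier := fun hc => hne (Subtype.ext (Prod.ext hi hc))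
    have hdisj := (h.isCover U.index).disjoint c (hi ▸ W.2 : W.carrier ∈ 𝒰 U.index c) U.2 hc
    exact disjoint_left.1 hdisj hW hU
  · exact (h.subset_hull _ _).trans (h.hull_subset_of_mem hW hU hle hne)

theorem above_of_above (h : IsAdapted X 𝒰) {W W' U : TreeVertex 𝒰 c} (hW : Above W U)
    (hW' : Above W' U) (hle : W.index ≤ W'.index) : Above W W' := by
  obtain ⟨z, hz⟩ := h.carrier_nonempty U
  exact h.above_of_mem (hW.subset hz) (hW'.subset hz) hle

theorem above_of_index_eq_zero (h : IsAdapted X 𝒰) {W : TreeVertex 𝒰 c} (hW : W.index = 0)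
    (U : TreeVertex 𝒰 c) : Above W U := by
  obtain ⟨z, hz⟩ := h.carrier_nonempty U
  have huniv : W.carrier = univ := by
    have hmem : W.carrier ∈ 𝒰 0 c := hW ▸ W.2
    rwa [h.zero] at hmem
  exact h.above_of_mem (huniv ▸ mem_univ z) hz (hW ▸ Nat.zero_le _)

theorem above_parent_self (h : IsAdapted X 𝒰) {U : TreeVertex 𝒰 c} (hU : U.index ≠ 0) :
    Above (h.parent U hU) U :=
  Or.inr (h.parent_spec U hU).1

theorem above_parent (h : IsAdapted X 𝒰) {W U : TreeVertex 𝒰 c} (hU : U.index ≠ 0)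
    (hWU : IsAncestor W U) : Above W (h.parent U hU) :=
  h.above_of_above (Or.inr hWU) (h.above_parent_self hU) ((h.parent_spec U hU).2 W hWU)

theorem dist_lt_of_mem (h : IsAdapted X 𝒰) {W : TreeVertex 𝒰 c} (hW : W.index ≠ 0) {x y : Z}
    (hx : x ∈ W.carrier) (hy : y ∈ W.carrier) : dist x y < r ^ W.index := by
  have hmesh : edist x y ≤ mesh (𝒰 W.index) :=
    (Metric.edist_le_ediam_of_mem hx hy).trans
      (le_iSup_of_le c (le_iSup₂_of_le W.carrier W.2 le_rfl))
  have hlt := hmesh.trans_lt (h.mesh_lt W.index (Nat.one_le_iff_ne_zero.2 hW))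
  rw [edist_dist] at hlt
  exact (ENNReal.ofReal_lt_ofReal_iff (pow_pos X.r_pos _)).1 hlt

theorem tree_induction (h : IsAdapted X 𝒰) {p : TreeVertex 𝒰 c → Prop}
    (root : ∀ U, U.index = 0 → p U)
    (step : ∀ U (hU : U.index ≠ 0), p (h.parent U hU) → p U) (U : TreeVertex 𝒰 c) : p U := by
  by_cases hU : U.index = 0
  · exact root U hU
  · exact step U hU (h.tree_induction root step (h.parent U hU))
termination_by U.index
decreasing_by exact (h.parent_spec U hU).1.1

/-- The number of edges of the path in `T_c` from the root to `U`. -/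
noncomputable def depth (h : IsAdapted X 𝒰) (U : TreeVertex 𝒰 c) : ℕ :=
  if hU : U.index = 0 then 0 else h.depth (h.parent U hU) + 1
termination_by U.index
decreasing_by exact (h.parent_spec U hU).1.1

theorem depth_of_index_eq_zero (h : IsAdapted X 𝒰) {U : TreeVertex 𝒰 c} (hU : U.index = 0) :
    h.depth U = 0 := by
  rw [depth, dif_pos hU]

theorem depth_of_index_ne_zero (h : IsAdapted X 𝒰) {U : TreeVertex 𝒰 c} (hU : U.index ≠ 0) :
    h.depth U = h.depth (h.parent U hU) + 1 := by
  rw [depth, dif_neg hU]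

theorem depth_add_index_le (h : IsAdapted X 𝒰) {W U : TreeVertex 𝒰 c} (hWU : Above W U) :
    h.depth U + W.index ≤ h.depth W + U.index := by
  induction U using h.tree_induction with
  | root U hU =>
    have := hWU.index_le
    rw [h.depth_of_index_eq_zero hU]
    omega
  | step U hU ih =>
    rcases hWU with rfl | hWU
    · exact le_rfl
    · have hlt := (h.parent_spec U hU).1.1
      have hle := ih (h.above_parent hU hWU)
      rw [h.depth_of_index_ne_zero hU]
      omega

theorem depth_le_of_above (h : IsAdapted X 𝒰) {W U : TreeVertex 𝒰 c} (hWU : Above W U) :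
    h.depth W ≤ h.depth U := by
  induction U using h.tree_induction with
  | root U hU =>
    rw [h.depth_of_index_eq_zero (Nat.le_zero.1 (hU ▸ hWU.index_le))]
    exact Nat.zero_le _
  | step U hU ih =>
    rcases hWU with rfl | hWU
    · exact le_rfl
    · rw [h.depth_of_index_ne_zero hU]
      exact (ih (h.above_parent hU hWU)).trans (Nat.le_succ _)

theorem depth_lt_of_isAncestor (h : IsAdapted X 𝒰) {W U : TreeVertex 𝒰 c}
    (hWU : IsAncestor W U) : h.depth W < h.depth U := by
  have hU : U.index ≠ 0 := (Nat.zero_le _).trans_lt hWU.1 |>.ne'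
  rw [h.depth_of_index_ne_zero hU]
  exact Nat.lt_succ_of_le (h.depth_le_of_above (h.above_parent hU hWU))

theorem above_of_depth_le (h : IsAdapted X 𝒰) {W W' U : TreeVertex 𝒰 c} (hW : Above W U)
    (hW' : Above W' U) (hle : h.depth W ≤ h.depth W') : Above W W' := by
  rcases le_total W.index W'.index with hi | hi
  · exact h.above_of_above hW hW' hi
  · rcases h.above_of_above hW' hW hi with rfl | hanc
    · exact .refl _
    · exact absurd hle (h.depth_lt_of_isAncestor hanc).not_ge

theorem depth_injOn (h : IsAdapted X 𝒰) (U : TreeVertex 𝒰 c) :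
    InjOn h.depth {W | Above W U} := by
  intro W hW W' hW' heq
  rcases h.above_of_depth_le hW hW' heq.le with rfl | hanc
  · rfl
  · exact absurd heq (h.depth_lt_of_isAncestor hanc).ne

theorem finite_above (h : IsAdapted X 𝒰) (U : TreeVertex 𝒰 c) : {W | Above W U}.Finite := by
  refine .of_injOn (f := h.depth) (t := Iic (h.depth U)) (fun W hW => ?_) (h.depth_injOn U)
    (finite_Iic _)
  exact h.depth_le_of_above hW

theorem exists_isMeet (h : IsAdapted X 𝒰) (U U' : TreeVertex 𝒰 c) : ∃ T, IsMeet T U U' := by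
  obtain ⟨T, ⟨hTU, hTU'⟩, hmax⟩ := exists_max_image {W | Above W U ∧ Above W U'}
    TreeVertex.index ((h.finite_above U).subset fun W hW => hW.1)
    ⟨h.root c, h.above_of_index_eq_zero rfl U, h.above_of_index_eq_zero rfl U'⟩
  exact ⟨T, hTU, hTU', fun W hW hW' => h.above_of_above hW hTU (hmax W ⟨hW, hW'⟩)⟩

theorem exists_above_depth_eq (h : IsAdapted X 𝒰) (U : TreeVertex 𝒰 c) {n : ℕ}
    (hn : n ≤ h.depth U) : ∃ W, Above W U ∧ h.depth W = n := by
  induction U using h.tree_induction with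
  | root U hU =>
    rw [h.depth_of_index_eq_zero hU] at hn
    exact ⟨U, .refl U, by rw [h.depth_of_index_eq_zero hU]; omega⟩
  | step U hU ih =>
    rcases hn.eq_or_lt with rfl | hlt
    · exact ⟨U, .refl U, rfl⟩
    · rw [h.depth_of_index_ne_zero hU] at hlt
      obtain ⟨W, hW, hWn⟩ := ih (Nat.le_of_lt_succ hlt)
      exact ⟨W, hW.trans (h.above_parent_self hU), hWn⟩

section Sentence

variable (μ : X.Vertex → F)

theorem sentence_of_index_eq_zero (h : IsAdapted X 𝒰) {U : TreeVertex 𝒰 c} (hU : U.index = 0) :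
    h.sentence μ U = [] := by
  rw [sentence, dif_pos hU]

theorem sentence_of_index_ne_zero (h : IsAdapted X 𝒰) {U : TreeVertex 𝒰 c} (hU : U.index ≠ 0) :
    h.sentence μ U = h.sentence μ (h.parent U hU) ++
      [(h.edgeWord μ (h.parent U hU) U, stopSign X F U)] := by
  rw [sentence, dif_neg hU]

theorem length_sentence (h : IsAdapted X 𝒰) (U : TreeVertex 𝒰 c) :
    (h.sentence μ U).length = h.depth U := by
  induction U using h.tree_induction with
  | root U hU => rw [h.sentence_of_index_eq_zero μ hU, h.depth_of_index_eq_zero hU, List.length_nil]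
  | step U hU ih =>
    rw [h.sentence_of_index_ne_zero μ hU, h.depth_of_index_ne_zero hU, List.length_append, ih,
      List.length_singleton]

theorem sentence_prefix (h : IsAdapted X 𝒰) {W U : TreeVertex 𝒰 c} (hWU : Above W U) :
    h.sentence μ W <+: h.sentence μ U := by
  induction U using h.tree_induction with
  | root U hU =>
    rw [h.sentence_of_index_eq_zero μ (Nat.le_zero.1 (hU ▸ hWU.index_le))]
    exact List.nil_prefix
  | step U hU ih =>
    rcases hWU with rfl | hWU
    · exact List.prefix_rfl
    · rw [h.sentence_of_index_ne_zero μ hU]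
      exact (ih (h.above_parent hU hWU)).trans (List.prefix_append _ _)

theorem stopsMarked_sentence (h : IsAdapted X 𝒰) (U : TreeVertex 𝒰 c) :
    StopsMarked (fun x : Letter F => x.1.isNone) (h.sentence μ U) := by
  induction U using h.tree_induction with
  | root U hU =>
    rw [h.sentence_of_index_eq_zero μ hU]
    exact fun p hp => absurd hp List.not_mem_nil
  | step U hU ih =>
    rw [h.sentence_of_index_ne_zero μ hU]
    intro p hp
    rcases List.mem_append.1 hp with hp | hp
    · exact ih p hp
    · rw [List.mem_singleton.1 hp]
      refine ⟨fun x hx => ?_, rfl⟩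
      obtain ⟨i, rfl⟩ := List.mem_ofFn.1 hx
      rfl

theorem length_edgeWord_parent (h : IsAdapted X 𝒰) {U : TreeVertex 𝒰 c} (hU : U.index ≠ 0) :
    ((h.edgeWord μ (h.parent U hU) U).length : ℤ) =
      U.level X.k₀ - (h.parent U hU).level X.k₀ := by
  have hlt := h.level_lt_level (h.parent_spec U hU).1.1
  rw [edgeWord, List.length_ofFn]
  omega

theorem letters_sentence_of_index_ne_zero (h : IsAdapted X 𝒰) {U : TreeVertex 𝒰 c}
    (hU : U.index ≠ 0) : letters (h.sentence μ U) =
      letters (h.sentence μ (h.parent U hU)) ++ h.edgeWord μ (h.parent U hU) U := by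
  rw [h.sentence_of_index_ne_zero μ hU, letters_append]
  simp [letters]

theorem length_letters_sentence (h : IsAdapted X 𝒰) (U : TreeVertex 𝒰 c) :
    ((letters (h.sentence μ U)).length : ℤ) = U.level X.k₀ - X.k₀ := by
  induction U using h.tree_induction with
  | root U hU =>
    rw [h.sentence_of_index_eq_zero μ hU, level_of_index_eq_zero hU, sub_self]
    rfl
  | step U hU ih =>
    rw [h.letters_sentence_of_index_ne_zero μ hU, List.length_append, Nat.cast_add, ih,
      h.length_edgeWord_parent μ hU]
    ring

theorem length_text_sentence (h : IsAdapted X 𝒰) (U : TreeVertex 𝒰 c) :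
    ((text (h.sentence μ U)).length : ℤ) = U.level X.k₀ - X.k₀ + h.depth U := by
  rw [length_text, Nat.cast_add, h.length_letters_sentence, h.length_sentence]

theorem exists_getElem?_reverse_letters_sentence (h : IsAdapted X 𝒰) (U : TreeVertex 𝒰 c) (k : ℤ)
    (hk : X.k₀ < k) (hkU : k ≤ U.level X.k₀) :
    ∃ W : TreeVertex 𝒰 c, Above W U ∧ k ≤ W.level X.k₀ ∧
      (letters (h.sentence μ U)).reverse[(U.level X.k₀ - k).toNat]? =
        some (some (h.colorSet μ W k hk.le), morseThue k.toNat) := by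
  induction U using h.tree_induction with
  | root U hU =>
    rw [level_of_index_eq_zero hU] at hkU
    omega
  | step U hU ih =>
    have hlen := h.length_edgeWord_parent μ hU
    rw [h.letters_sentence_of_index_ne_zero μ hU, List.reverse_append]
    by_cases hkP : k ≤ (h.parent U hU).level X.k₀
    · obtain ⟨W, hW, hkW, hletter⟩ := ih hkP
      refine ⟨W, hW.trans (h.above_parent_self hU), hkW, ?_⟩
      rw [List.getElem?_append_right (by rw [List.length_reverse]; omega), ← hletter,
        List.length_reverse]
      congr 1
      omega
    · obtain ⟨i, rfl⟩ : ∃ i : ℕ, k = (h.parent U hU).level X.k₀ + 1 + i :=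
        ⟨(k - (h.parent U hU).level X.k₀ - 1).toNat, by omega⟩
      refine ⟨U, .refl U, hkU, ?_⟩
      rw [List.getElem?_append_left (by rw [List.length_reverse]; omega),
        List.getElem?_reverse (by omega)]
      have hi : (h.edgeWord μ (h.parent U hU) U).length - 1 -
          (U.level X.k₀ - ((h.parent U hU).level X.k₀ + 1 + i)).toNat = i := by omega
      rw [hi, edgeWord, List.getElem?_ofFn, dif_pos (by omega)]

end Sentence

theorem isImage_colorMap (h : IsAdapted X 𝒰) (c : C) (v : X.Vertex) (hv : v.level ≠ X.k₀) :
    IsImage v (h.colorMap c v) := by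
  rw [colorMap, dif_neg hv]
  exact (h.exists_isImage c v hv).choose_spec

theorem above_colorMap_iff (h : IsAdapted X 𝒰) (v : X.Vertex) {W : TreeVertex 𝒰 c}
    (hW : W.index ≠ 0) :
    Above W (h.colorMap c v) ↔ v.ball ⊆ W.carrier ∧ (W.index : ℤ) ≤ v.level - 1 := by
  have hk := h.k₀_nonpos
  by_cases hv : v.level = X.k₀
  · rw [colorMap, dif_pos hv]
    refine iff_of_false (fun hWU => hW (Nat.le_zero.1 hWU.index_le)) fun hWv => ?_
    have := hWv.2
    omega
  obtain ⟨⟨hsub, hle⟩, hmax⟩ := h.isImage_colorMap c v hv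
  refine ⟨fun hWU => ⟨hsub.trans hWU.subset, ?_⟩, fun ⟨hvW, hWv⟩ => ?_⟩
  · have := hWU.index_le
    rw [level_of_index_ne_zero (by omega)] at hle
    omega
  · refine h.above_of_mem (hvW v.point_mem_ball) (hsub v.point_mem_ball) (not_lt.1 fun hlt => ?_)
    have hlevel := hmax W hvW (by rwa [level_of_index_ne_zero hW])
    exact (h.level_lt_level hlt).not_ge hlevel

end IsAdapted

/-! ### The upper bound -/

namespace IsAdapted

variable {Z C : Type*} [MetricSpace Z] {r : ℝ} {X : HypApprox Z r} {𝒰 : ℕ → C → Set (Set Z)}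
  {F : Type*} {c : C}

theorem above_colorMap_of_ball_subset (h : IsAdapted X 𝒰) {v v' : X.Vertex}
    (hl : v'.level = v.level + 1) (hb : v'.ball ⊆ v.ball) :
    Above (h.colorMap c v) (h.colorMap c v') := by
  by_cases hU : (h.colorMap c v).index = 0
  · exact h.above_of_index_eq_zero hU _
  · obtain ⟨hsub, hle⟩ := (h.above_colorMap_iff v hU).1 (.refl _)
    exact (h.above_colorMap_iff v' hU).2 ⟨hb.trans hsub, by omega⟩

theorem above_parent_parent_of_ball_subset (h : IsAdapted X 𝒰) {v v' : X.Vertex}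
    (hl : v'.level = v.level + 1) (hb : v'.ball ⊆ v.ball) (hU' : (h.colorMap c v').index ≠ 0)
    (hP : (h.parent _ hU').index ≠ 0) :
    Above (h.parent (h.parent _ hU') hP) (h.colorMap c v) := by
  have hPU := (h.parent_spec _ hU').1
  have hGP := (h.parent_spec _ hP).1
  by_cases hG : (h.parent _ hP).index = 0
  · exact h.above_of_index_eq_zero hG _
  obtain ⟨hsub, hle⟩ := (h.above_colorMap_iff v' hU').1 (.refl _)
  have hi := hPU.1
  have hi' := hGP.1
  have hk := h.k₀_nonpos
  obtain ⟨w, hw, hvw, -⟩ := HypApprox.exists_walk_lower v ((h.parent _ hU').index + 1)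
    (by omega) (by omega)
  refine (h.above_colorMap_iff v hG).2 ⟨hvw.trans ?_, by omega⟩
  refine h.ball_subset_of_isAncestor hGP hw ⟨v'.point, ?_, ?_⟩
  · exact hvw (hb v'.point_mem_ball)
  · exact hPU.2 (hsub v'.point_mem_ball)

theorem depth_colorMap_le_of_ball_subset (h : IsAdapted X 𝒰) {v v' : X.Vertex}
    (hl : v'.level = v.level + 1) (hb : v'.ball ⊆ v.ball) :
    h.depth (h.colorMap c v') ≤ h.depth (h.colorMap c v) + 2 := by
  by_cases hU' : (h.colorMap c v').index = 0
  · rw [h.depth_of_index_eq_zero hU']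
    omega
  rw [h.depth_of_index_ne_zero hU']
  by_cases hP : (h.parent _ hU').index = 0
  · rw [h.depth_of_index_eq_zero hP]
    omega
  rw [h.depth_of_index_ne_zero hP]
  have := h.depth_le_of_above (h.above_parent_parent_of_ball_subset hl hb hU' hP)
  omega

/-- The coordinate of `ψ ∘ f` of the color `c`. -/
noncomputable def vertexDiary (h : IsAdapted X 𝒰) (μ : X.Vertex → F) (κ : ℕ) (c : C)
    (v : X.Vertex) : List (Page κ (Letter F)) :=
  diary κ (h.sentence μ (h.colorMap c v))

/-- The distance in `T_Ω` of the coordinates of `ψ (f v)` and `ψ (f v')` of the color `c`. -/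
noncomputable def diaryDist (h : IsAdapted X 𝒰) (μ : X.Vertex → F) (κ : ℕ) (c : C)
    (v v' : X.Vertex) : ℕ :=
  (wordTree _).dist (h.vertexDiary μ κ c v) (h.vertexDiary μ κ c v')

variable (μ : X.Vertex → F) (κ : ℕ)

theorem length_vertexDiary (h : IsAdapted X 𝒰) (v : X.Vertex) :
    (h.vertexDiary μ κ c v).length = h.depth (h.colorMap c v) := by
  rw [vertexDiary, length_diary, h.length_sentence]

theorem diaryDist_comm (h : IsAdapted X 𝒰) (v v' : X.Vertex) :
    h.diaryDist μ κ c v v' = h.diaryDist μ κ c v' v :=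
  SimpleGraph.dist_comm

theorem diaryDist_triangle (h : IsAdapted X 𝒰) (u v w : X.Vertex) :
    h.diaryDist μ κ c u w ≤ h.diaryDist μ κ c u v + h.diaryDist μ κ c v w :=
  wordTree_connected.dist_triangle

theorem diaryDist_le_two_of_ball_subset (h : IsAdapted X 𝒰) {v v' : X.Vertex}
    (hl : v'.level = v.level + 1) (hb : v'.ball ⊆ v.ball) : h.diaryDist μ κ c v v' ≤ 2 := by
  obtain ⟨E, hE⟩ : h.vertexDiary μ κ c v <+: h.vertexDiary μ κ c v' :=
    diary_prefix κ (h.sentence_prefix μ (h.above_colorMap_of_ball_subset hl hb))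
  have hlen := congrArg List.length hE
  rw [List.length_append, h.length_vertexDiary, h.length_vertexDiary] at hlen
  have hdepth := h.depth_colorMap_le_of_ball_subset (c := c) hl hb
  rw [diaryDist, ← hE]
  exact (wordTree_dist_append_le _ E).trans (by omega)

theorem diaryDist_le_four_of_adj (h : IsAdapted X 𝒰) {v v' : X.Vertex} (hadj : X.graph.Adj v v') :
    h.diaryDist μ κ c v v' ≤ 4 := by
  obtain ⟨hne, ⟨hl, hmeet⟩ | ⟨hl, hb⟩ | ⟨hl, hb⟩⟩ := hadj
  · have hv : v.level ≠ X.k₀ := fun hv => hne (HypApprox.eq_of_level_eq_k₀ hv (hl ▸ hv))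
    have hv' : X.k₀ ≤ v.level := v.2.1
    obtain ⟨u, hu, hb, hb'⟩ := HypApprox.exists_ball_subset_of_closedBall_inter v v' (v.level - 1)
      (by omega) (by omega) (by omega) hmeet
    calc h.diaryDist μ κ c v v'
        ≤ h.diaryDist μ κ c v u + h.diaryDist μ κ c u v' := h.diaryDist_triangle μ κ v u v'
      _ = h.diaryDist μ κ c u v + h.diaryDist μ κ c u v' := by rw [h.diaryDist_comm μ κ v u]
      _ ≤ 2 + 2 := add_le_add (h.diaryDist_le_two_of_ball_subset μ κ (by omega) hb)
          (h.diaryDist_le_two_of_ball_subset μ κ (by omega) hb')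
  · exact (h.diaryDist_le_two_of_ball_subset μ κ hl hb).trans (by omega)
  · rw [h.diaryDist_comm]
    exact (h.diaryDist_le_two_of_ball_subset μ κ hl hb).trans (by omega)

theorem diaryDist_le_four_mul_length (h : IsAdapted X 𝒰) {v v' : X.Vertex}
    (p : X.graph.Walk v v') : h.diaryDist μ κ c v v' ≤ 4 * p.length := by
  induction p with
  | nil => exact SimpleGraph.dist_self.trans_le (Nat.zero_le _)
  | @cons v u v' hadj p ih =>
    have hle := h.diaryDist_le_four_of_adj μ κ (c := c) hadj
    have htri := h.diaryDist_triangle μ κ (c := c) v u v'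
    rw [SimpleGraph.Walk.length_cons]
    omega

end IsAdapted

/-! ### Levels and positions from the letters -/

/-- A long equal factor at a small shift would contain a cube. -/
theorem eq_of_morseThue_eq {a b R : ℕ} (ha : R ≤ a + 1) (hb : R ≤ b + 1)
    (hab : 2 * (b - a) ≤ R) (hba : 2 * (a - b) ≤ R)
    (h : ∀ x < R, morseThue (a - x) = morseThue (b - x)) : a = b := by
  wlog hle : a ≤ b generalizing a b
  · exact (this hb ha hba hab (fun x hx => (h x hx).symm) (le_of_not_ge hle)).symm
  by_contra hne
  obtain ⟨k, hk, hk', hkne⟩ := morseThue_cube_free (s := b - a) (by omega) (a + 1 - 2 * (b - a))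
  have heq := h (a - k) (by omega)
  rw [show a - (a - k) = k by omega, show b - (a - k) = k + (b - a) by omega] at heq
  exact hkne heq

theorem getElem?_reverse_eq_of_suffix {α : Type*} {K l l' : List α} (h : K <:+ l) (h' : K <:+ l')
    {i : ℕ} (hi : i < K.length) : l.reverse[i]? = l'.reverse[i]? := by
  obtain ⟨m, rfl⟩ := h
  obtain ⟨m', rfl⟩ := h'
  have hi' : i < K.reverse.length := by rwa [List.length_reverse]
  rw [List.reverse_append, List.reverse_append, List.getElem?_append_left hi',
    List.getElem?_append_left hi']

theorem HypApprox.dist_le_of_k₀ {Z : Type*} [MetricSpace Z] {r : ℝ} (X : HypApprox Z r) (x y : Z) :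
    dist x y ≤ 5 / 3 * r ^ X.k₀ := by
  have hle := Metric.dist_le_diam_of_mem X.isBounded (mem_univ x) (mem_univ y)
  have hlt : Metric.diam (univ : Set Z) < r ^ X.k₀ := X.isGreatest_k₀.1
  have hpos := zpow_pos X.r_pos X.k₀
  linarith

namespace IsAdapted

variable {Z C : Type*} [MetricSpace Z] {r : ℝ} {X : HypApprox Z r} {𝒰 : ℕ → C → Set (Set Z)}
  {F : Type*} {c : C} {μ : X.Vertex → F}

theorem neg_one_le_k₀ (h : IsAdapted X 𝒰) : -1 ≤ X.k₀ := by
  refine X.isGreatest_k₀.2 ?_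
  change Metric.diam (univ : Set Z) < r ^ (-1 : ℤ)
  rw [zpow_neg_one]
  exact lt_inv_of_lt_inv₀ X.r_pos (by simpa only [one_div] using (lt_min_iff.1 h.r_lt).2)

theorem dist_lt_zpow_of_mem (h : IsAdapted X 𝒰) {W : TreeVertex 𝒰 c} {k : ℤ} (hk : X.k₀ < k)
    (hkW : k ≤ W.level X.k₀) {x y : Z} (hx : x ∈ W.carrier) (hy : y ∈ W.carrier) :
    dist x y < r ^ k := by
  have hW : W.index ≠ 0 := fun hW => by
    rw [level_of_index_eq_zero hW] at hkW
    omega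
  rw [level_of_index_ne_zero hW] at hkW
  calc dist x y < r ^ W.index := h.dist_lt_of_mem hW hx hy
    _ = r ^ (W.index : ℤ) := (zpow_natCast r _).symm
    _ ≤ r ^ k := X.zpow_anti hkW

/-- A net point `w` near `x` has a color of the common set, hence so has a net point `w'` near the
small set `W'`; since `x` and `x'` are close and `μ` is proper, `w' = w`. -/
theorem dist_le_of_colorSet_eq (h : IsAdapted X 𝒰) (hμ : X.IsProperColoring μ)
    {W W' : TreeVertex 𝒰 c} {x x' : Z} (hx : x ∈ W.carrier) (hx' : x' ∈ W'.carrier) {k : ℤ}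
    (hk : X.k₀ < k) (hkW' : k ≤ W'.level X.k₀)
    (hc : h.colorSet μ W k hk.le = h.colorSet μ W' k hk.le)
    (hd : dist x x' ≤ 5 / 3 * r ^ (k - 1)) : dist x x' ≤ 5 / 3 * r ^ k := by
  obtain ⟨w, hw, hxw⟩ := X.exists_dist_lt x (k + 1) (by omega)
  have hpos := zpow_pos X.r_pos (k + 1)
  have hr := X.zpow_add_one_le k
  have hr' := X.zpow_add_one_le (k - 1)
  rw [sub_add_cancel] at hr'
  have hxball : x ∈ w.ball := by
    rw [HypApprox.Vertex.ball, Metric.mem_ball, hw]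
    linarith
  have hcolor : μ w ∈ (h.colorSet μ W k hk.le).1 := ⟨w, hw, ⟨x, hxball, hx⟩, rfl⟩
  rw [hc] at hcolor
  obtain ⟨w', hw', ⟨y, hyball, hy⟩, hμw⟩ := hcolor
  rw [HypApprox.Vertex.ball, Metric.mem_ball, hw'] at hyball
  have hyx := h.dist_lt_zpow_of_mem hk hkW' hy hx'
  obtain rfl : w = w' := by
    by_contra hne
    refine hμ w w' hne (hw.trans hw'.symm) ?_ hμw.symm
    rw [hw, show k + 1 - 2 = k - 1 by ring]
    calc dist w.point w'.point ≤ dist w.point x + dist x x' + dist x' w'.point :=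
          dist_triangle4 _ _ _ _
      _ ≤ dist x w.point + dist x x' + (dist y x' + dist y w'.point) := by
          rw [dist_comm w.point x]
          gcongr
          exact dist_triangle_left _ _ _
      _ < 2 * r ^ (k - 1) := by linarith
  calc dist x x' ≤ dist x w.point + dist w.point y + dist y x' := dist_triangle4 _ _ _ _
    _ = dist x w.point + dist y w.point + dist y x' := by rw [dist_comm w.point y]
    _ ≤ 5 / 3 * r ^ k := by linarith

theorem dist_le_of_common_suffix (h : IsAdapted X 𝒰) (hμ : X.IsProperColoring μ)
    {Y Y' : TreeVertex 𝒰 c} {x x' : Z} (hx : x ∈ Y.carrier) (hx' : x' ∈ Y'.carrier)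
    (hlevel : Y.level X.k₀ = Y'.level X.k₀) {K : List (Letter F)}
    (hK : K <:+ letters (h.sentence μ Y)) (hK' : K <:+ letters (h.sentence μ Y'))
    (hd : dist x x' ≤ 5 / 3 * r ^ (Y.level X.k₀ - K.length)) :
    dist x x' ≤ 5 / 3 * r ^ Y.level X.k₀ := by
  have hlen := h.length_letters_sentence μ Y
  have hKlen := hK.length_le
  suffices hclose : ∀ k, Y.level X.k₀ - K.length ≤ k → k ≤ Y.level X.k₀ →
      dist x x' ≤ 5 / 3 * r ^ k from hclose _ (by omega) le_rfl
  intro k hk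
  induction k, hk using Int.leInduction with
  | base => exact fun _ => hd
  | succ k hk ih =>
    intro hkY
    obtain ⟨W, hW, -, hletter⟩ :=
      h.exists_getElem?_reverse_letters_sentence μ Y (k + 1) (by omega) hkY
    obtain ⟨W', hW', hkW', hletter'⟩ :=
      h.exists_getElem?_reverse_letters_sentence μ Y' (k + 1) (by omega) (hlevel ▸ hkY)
    rw [getElem?_reverse_eq_of_suffix hK hK' (by omega), hlevel, hletter'] at hletter
    have hcolor := Option.some.inj (congrArg Prod.fst (Option.some.inj hletter))
    exact h.dist_le_of_colorSet_eq hμ (hW.subset hx) (hW'.subset hx') (by omega) hkW' hcolor.symm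
      (by rw [add_sub_cancel_right]; exact ih (by omega))

theorem index_eq_of_common_suffix (h : IsAdapted X 𝒰) {Y Y' : TreeVertex 𝒰 c} (hY : Y.index ≠ 0)
    (hY' : Y'.index ≠ 0) {K : List (Letter F)} (hK : K <:+ letters (h.sentence μ Y))
    (hK' : K <:+ letters (h.sentence μ Y'))
    (hle : 2 * ((Y.index : ℤ) - Y'.index) ≤ K.length)
    (hle' : 2 * ((Y'.index : ℤ) - Y.index) ≤ K.length) : Y.index = Y'.index := by
  have hk := h.k₀_nonpos
  have hk' := h.neg_one_le_k₀
  have hKlen := hK.length_le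
  have hKlen' := hK'.length_le
  have hlen := h.length_letters_sentence μ Y
  have hlen' := h.length_letters_sentence μ Y'
  have hlevel := level_of_index_ne_zero (k₀ := X.k₀) hY
  have hlevel' := level_of_index_ne_zero (k₀ := X.k₀) hY'
  refine eq_of_morseThue_eq (R := K.length) (by omega) (by omega) (by omega) (by omega)
    fun x hx => ?_
  obtain ⟨W, -, -, hletter⟩ :=
    h.exists_getElem?_reverse_letters_sentence μ Y (Y.level X.k₀ - x) (by omega) (by omega)
  obtain ⟨W', -, -, hletter'⟩ :=
    h.exists_getElem?_reverse_letters_sentence μ Y' (Y'.level X.k₀ - x) (by omega) (by omega)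
  rw [sub_sub_cancel, Int.toNat_natCast] at hletter hletter'
  rw [getElem?_reverse_eq_of_suffix hK hK' hx, hletter'] at hletter
  have hdecoration : morseThue (Y'.level X.k₀ - x).toNat = morseThue (Y.level X.k₀ - x).toNat :=
    congrArg Prod.snd (Option.some.inj hletter)
  rw [hlevel, hlevel', show ((Y'.index : ℤ) - x).toNat = Y'.index - x by omega,
    show ((Y.index : ℤ) - x).toNat = Y.index - x by omega] at hdecoration
  exact hdecoration.symm

theorem index_eq_and_dist_le_of_letters (h : IsAdapted X 𝒰) (hμ : X.IsProperColoring μ)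
    {Y Y' : TreeVertex 𝒰 c} (hY : Y.index ≠ 0) (hY' : Y'.index ≠ 0) {x x' : Z}
    (hx : x ∈ Y.carrier) (hx' : x' ∈ Y'.carrier) {l : ℤ} {m : ℕ}
    (hd : dist x x' ≤ 5 / 3 * r ^ l) (hm : 2 * ((Y.index : ℤ) - Y'.index) ≤ m)
    (hm' : 2 * ((Y'.index : ℤ) - Y.index) ≤ m) (hml : (Y.index : ℤ) - l ≤ m)
    (hread : letters (h.sentence μ Y) = letters (h.sentence μ Y') ∨ ∃ K, m ≤ K.length ∧
      K <:+ letters (h.sentence μ Y) ∧ K <:+ letters (h.sentence μ Y')) :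
    Y.index = Y'.index ∧ dist x x' ≤ 5 / 3 * r ^ (Y.index : ℤ) := by
  have hlevel := level_of_index_ne_zero (k₀ := X.k₀) hY
  have hlevel' := level_of_index_ne_zero (k₀ := X.k₀) hY'
  rcases hread with heq | ⟨K, hmK, hK, hK'⟩
  · have hlen := h.length_letters_sentence μ Y
    have hlen' := h.length_letters_sentence μ Y'
    rw [← heq] at hlen'
    refine ⟨by omega, hlevel ▸ h.dist_le_of_common_suffix hμ hx hx' (by omega)
      List.suffix_rfl (heq ▸ List.suffix_rfl) ?_⟩
    rw [hlen, sub_sub_cancel]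
    exact X.dist_le_of_k₀ x x'
  · have hindex : Y.index = Y'.index :=
      h.index_eq_of_common_suffix hY hY' hK hK' (by omega) (by omega)
    refine ⟨hindex, hlevel ▸ h.dist_le_of_common_suffix hμ hx hx' (by omega) hK hK' ?_⟩
    have hpow := X.zpow_anti (show Y.level X.k₀ - K.length ≤ l by omega)
    linarith

end IsAdapted

/-! ### The lower bound -/

/-- The level `l` at which the ways from `v` and `v'` towards the root of `X` have come close to
each other: up to a bounded error, `|vv'| = ℓ(v) + ℓ(v') - 2 l`. -/
def HypApprox.IsBranchLevel {Z : Type*} [MetricSpace Z] {r : ℝ} {X : HypApprox Z r}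
    (v v' : X.Vertex) (l : ℤ) : Prop :=
  IsGreatest {k : ℤ | k ≤ v.level ∧ k ≤ v'.level ∧ dist v.point v'.point ≤ 5 / 3 * r ^ k} l

namespace HypApprox

variable {Z : Type*} [MetricSpace Z] {r : ℝ} {X : HypApprox Z r}

theorem IsBranchLevel.symm {v v' : X.Vertex} {l : ℤ} (h : IsBranchLevel v v' l) :
    IsBranchLevel v' v l := by
  obtain ⟨⟨hlv, hlv', hd⟩, hmax⟩ := h
  refine ⟨⟨hlv', hlv, by rwa [dist_comm]⟩, fun k hk => hmax ⟨hk.2.1, hk.1, ?_⟩⟩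
  rw [dist_comm]
  exact hk.2.2

theorem exists_isBranchLevel (v v' : X.Vertex) : ∃ l, IsBranchLevel v v' l ∧ X.k₀ ≤ l := by
  have hk₀ : X.k₀ ≤ v.level ∧ X.k₀ ≤ v'.level ∧ dist v.point v'.point ≤ 5 / 3 * r ^ X.k₀ :=
    ⟨v.2.1, v'.2.1, X.dist_le_of_k₀ _ _⟩
  obtain ⟨l, hl, hmax⟩ := Int.exists_greatest_of_bdd
    (P := fun k => k ≤ v.level ∧ k ≤ v'.level ∧ dist v.point v'.point ≤ 5 / 3 * r ^ k)
    ⟨v.level, fun _ hk => hk.1⟩ ⟨X.k₀, hk₀⟩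
  exact ⟨l, ⟨hl, hmax⟩, hmax _ hk₀⟩

end HypApprox

namespace IsAdapted

open HypApprox

variable {Z C : Type*} [MetricSpace Z] {r : ℝ} {X : HypApprox Z r} {𝒰 : ℕ → C → Set (Set Z)}
  {F : Type*} {c : C} {v v' : X.Vertex} {l : ℤ}

theorem above_colorMap_of_isAncestor (h : IsAdapted X 𝒰) (hl : IsBranchLevel v v' l)
    {W Y : TreeVertex 𝒰 c} (hWY : IsAncestor W Y) (hY : Above Y (h.colorMap c v))
    (hYl : (Y.index : ℤ) ≤ l - 2) : Above W (h.colorMap c v') := by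
  obtain ⟨-, hlv', hd⟩ := hl.1
  by_cases hW : W.index = 0
  · exact h.above_of_index_eq_zero hW _
  have hindex := hWY.1
  have hk := h.k₀_nonpos
  obtain ⟨hvY, -⟩ := (h.above_colorMap_iff v (by omega)).1 hY
  obtain ⟨w, hw, hvw⟩ := X.exists_dist_lt v.point ((Y.index : ℤ) + 1) (by omega)
  have hpos := zpow_pos X.r_pos ((Y.index : ℤ) + 1)
  have hr := X.zpow_add_one_le ((Y.index : ℤ) + 1)
  have hrl := X.zpow_anti (show (Y.index : ℤ) + 1 + 1 ≤ l by omega)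
  have hrv' := X.zpow_anti hlv'
  have hwW : w.ball ⊆ W.carrier := by
    refine h.ball_subset_of_isAncestor hWY hw ⟨v.point, ?_, hvY v.point_mem_ball⟩
    rw [HypApprox.Vertex.ball, Metric.mem_ball, hw]
    linarith
  refine (h.above_colorMap_iff v' hW).2 ⟨(Metric.ball_subset_ball' ?_).trans hwW, by omega⟩
  have htri := dist_triangle_left v'.point w.point v.point
  rw [hw]
  linarith

theorem index_le_of_above_of_above (h : IsAdapted X 𝒰) (hl : IsBranchLevel v v' l)
    {W : TreeVertex 𝒰 c} (hW : W.index ≠ 0) (hWv : Above W (h.colorMap c v))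
    (hWv' : Above W (h.colorMap c v')) : (W.index : ℤ) ≤ l := by
  obtain ⟨hvW, hWlv⟩ := (h.above_colorMap_iff v hW).1 hWv
  obtain ⟨hvW', hWlv'⟩ := (h.above_colorMap_iff v' hW).1 hWv'
  refine hl.2 ⟨by omega, by omega, ?_⟩
  have hd := h.dist_lt_of_mem hW (hvW v.point_mem_ball) (hvW' v'.point_mem_ball)
  have hpos := pow_pos X.r_pos W.index
  rw [zpow_natCast]
  linarith

theorem index_ne_zero_of_depth_ne_zero (h : IsAdapted X 𝒰) {W : TreeVertex 𝒰 c}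
    (hW : h.depth W ≠ 0) : W.index ≠ 0 :=
  fun hindex => hW (h.depth_of_index_eq_zero hindex)

theorem le_index_of_isMeet_of_depth_eq (h : IsAdapted X 𝒰) (hl : IsBranchLevel v v' l)
    {T W : TreeVertex 𝒰 c} (hT : IsMeet T (h.colorMap c v) (h.colorMap c v'))
    (hW : Above W (h.colorMap c v)) (hTW : h.depth W = h.depth T + 2) : l - 1 ≤ W.index := by
  have hindex := h.index_ne_zero_of_depth_ne_zero (W := W) (by omega)
  have hP := (h.parent_spec W hindex).1
  rw [h.depth_of_index_ne_zero hindex] at hTW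
  by_contra! hlt
  have hPT := hT.2.2 _ ((h.above_parent_self hindex).trans hW)
    (h.above_colorMap_of_isAncestor hl hP hW (by omega))
  have hdepth := h.depth_le_of_above hPT
  omega

theorem le_index_of_isMeet (h : IsAdapted X 𝒰) (hl : IsBranchLevel v v' l)
    {T W : TreeVertex 𝒰 c} (hT : IsMeet T (h.colorMap c v) (h.colorMap c v'))
    (hW : Above W (h.colorMap c v)) (hTW : h.depth T + 2 ≤ h.depth W) :
    l + h.depth W ≤ W.index + h.depth T + 3 := by
  obtain ⟨W₂, hW₂, hdepth⟩ := h.exists_above_depth_eq W hTW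
  have hlow := h.le_index_of_isMeet_of_depth_eq hl hT (hW₂.trans hW) hdepth
  have hle := h.depth_add_index_le hW₂
  omega

variable (μ : X.Vertex → F)

theorem length_text_drop_sentence (h : IsAdapted X 𝒰) {W Y : TreeVertex 𝒰 c} (hWY : Above W Y) :
    ((text ((h.sentence μ Y).drop (h.depth W))).length : ℤ) =
      Y.level X.k₀ - W.level X.k₀ + (h.depth Y - h.depth W) := by
  obtain ⟨E, hE⟩ := h.sentence_prefix μ hWY
  have hY := h.length_text_sentence μ Y
  have hW := h.length_text_sentence μ W
  rw [← hE, text_append, List.length_append, Nat.cast_add] at hY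
  rw [← hE, ← h.length_sentence μ W, List.drop_left]
  rw [h.length_sentence]
  linarith

theorem letters_sentence_eq_or (h : IsAdapted X 𝒰) {κ : ℕ} {T Y Y' : TreeVertex 𝒰 c}
    (hTY : Above T Y) (hTY' : Above T Y') (hdepth : h.depth Y = h.depth Y')
    (hdiary : diary κ (h.sentence μ Y) = diary κ (h.sentence μ Y'))
    (hslow : ∀ W, Above W Y → h.depth T + 2 ≤ h.depth W →
      Y.level X.k₀ - W.level X.k₀ ≤ ((κ : ℤ) - 1) * (h.depth Y - h.depth W)) :
    letters (h.sentence μ Y) = letters (h.sentence μ Y') ∨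
      ∃ K, (κ - 1) * (h.depth Y - h.depth T - 1) ≤ K.length ∧
        K <:+ letters (h.sentence μ Y) ∧ K <:+ letters (h.sentence μ Y') := by
  obtain ⟨σ, hσ⟩ := h.sentence_prefix μ hTY
  obtain ⟨σ', hσ'⟩ := h.sentence_prefix μ hTY'
  have hlen : h.depth T + σ.length = h.depth Y := by
    rw [← h.length_sentence μ T, ← h.length_sentence μ Y, ← hσ, List.length_append]
  have hlen' : h.depth T + σ'.length = h.depth Y' := by
    rw [← h.length_sentence μ T, ← h.length_sentence μ Y', ← hσ', List.length_append]
  have hm := h.stopsMarked_sentence μ Y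
  have hm' := h.stopsMarked_sentence μ Y'
  have htext : ∀ d, 2 ≤ d → (text (σ.drop d)).length ≤ κ * (σ.drop d).length := by
    intro d hd
    rcases le_total σ.length d with hσd | hdσ
    · rw [List.drop_of_length_le hσd]
      exact Nat.zero_le _
    obtain ⟨W, hWY, hW⟩ := h.exists_above_depth_eq Y (n := h.depth T + d) (by omega)
    have hW' := hslow W hWY (by omega)
    have htextW := h.length_text_drop_sentence μ hWY
    rw [hW, ← hσ, ← h.length_sentence μ T, List.drop_length_add_append, h.length_sentence] at htextW
    rw [hW] at hW'
    have hdrop : ((σ.drop d).length : ℤ) = h.depth Y - (h.depth T + d : ℕ) := by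
      rw [List.length_drop]
      omega
    zify
    rw [htextW, hdrop]
    linarith
  rw [← hσ] at hm hdiary ⊢
  rw [← hσ'] at hm' hdiary ⊢
  rw [show h.depth Y - h.depth T - 1 = σ.length - 1 by omega]
  exact letters_eq_or_exists_common_suffix (by omega) hm hm' hdiary htext

variable {μ}

theorem diary_sentence_eq_take (h : IsAdapted X 𝒰) {κ : ℕ} {Y U : TreeVertex 𝒰 c}
    (hYU : Above Y U) {D : List (Page κ (Letter F))} (hD : D <+: diary κ (h.sentence μ U))
    (hY : h.depth Y ≤ D.length) : diary κ (h.sentence μ Y) = D.take (h.depth Y) := by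
  have hlen : (diary κ (h.sentence μ Y)).length = h.depth Y := by
    rw [length_diary, h.length_sentence]
  have hprefix : diary κ (h.sentence μ Y) <+: D :=
    List.prefix_of_prefix_length_le (diary_prefix κ (h.sentence_prefix μ hYU)) hD (hlen ▸ hY)
  rw [List.prefix_iff_eq_take.1 hprefix, hlen]

theorem exists_above_maximizing (h : IsAdapted X 𝒰) (U : TreeVertex 𝒰 c) (K : ℤ) {a b : ℕ}
    (hab : a ≤ b) (hb : b ≤ h.depth U) : ∃ Y, Above Y U ∧ a ≤ h.depth Y ∧ h.depth Y ≤ b ∧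
      ∀ W, Above W U → a ≤ h.depth W → h.depth W ≤ b →
        K * h.depth W - W.index ≤ K * h.depth Y - Y.index := by
  obtain ⟨B, hBU, hB⟩ := h.exists_above_depth_eq U hb
  obtain ⟨Y, ⟨hYU, haY, hYb⟩, hmax⟩ := exists_max_image
    {W | Above W U ∧ a ≤ h.depth W ∧ h.depth W ≤ b} (fun W => K * h.depth W - (W.index : ℤ))
    ((h.finite_above U).subset fun W hW => hW.1) ⟨B, hBU, hB ▸ hab, hB.le⟩
  exact ⟨Y, hYU, haY, hYb, fun W hWU haW hWb => hmax W ⟨hWU, haW, hWb⟩⟩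

/-- Among the vertices whose diary is a part of the common diary, the one maximizing
`(κ - 1) * depth - index` has a sentence whose last words are short on the average, so that many
of its last letters can be recovered from its diary. -/
theorem exists_above_level_sub_le (h : IsAdapted X 𝒰) (hl : IsBranchLevel v v' l)
    {T : TreeVertex 𝒰 c} (hT : IsMeet T (h.colorMap c v) (h.colorMap c v')) {K : ℤ} (hK : 0 < K)
    {b : ℕ} (hb : b ≤ h.depth (h.colorMap c v))
    (hbig : 3 * (v.level - l) + 3 * K < K * (b - h.depth T - 1)) :
    ∃ Y, Above Y (h.colorMap c v) ∧ h.depth T + 4 < h.depth Y ∧ h.depth Y ≤ b ∧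
      2 * (v.level - l) < K * (h.depth Y - h.depth T - 1) ∧
      ∀ W, Above W Y → h.depth T + 2 ≤ h.depth W →
        Y.level X.k₀ - W.level X.k₀ ≤ K * (h.depth Y - h.depth W) := by
  have hlv : l ≤ v.level := hl.1.1
  have hTb : (3 : ℤ) < b - h.depth T - 1 := by
    refine lt_of_mul_lt_mul_left ?_ hK.le
    linarith
  obtain ⟨Y, hYU, hTY, hYb, hmax⟩ := h.exists_above_maximizing (h.colorMap c v) K
    (a := h.depth T + 2) (b := b) (by omega) hb
  obtain ⟨B, hBU, hB⟩ := h.exists_above_depth_eq _ hb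
  have hY := h.index_ne_zero_of_depth_ne_zero (W := Y) (by omega)
  have hB' := h.index_ne_zero_of_depth_ne_zero (W := B) (by omega)
  have hBv := ((h.above_colorMap_iff v hB').1 hBU).2
  have hlY := h.le_index_of_isMeet hl hT hYU hTY
  have hBY := hmax B hBU (by omega) hB.le
  rw [hB] at hBY
  have hlong : 2 * (v.level - l) + 3 * K < K * (h.depth Y - h.depth T - 1) := by
    have hBl : (B.index : ℤ) - Y.index ≤ v.level - l := by omega
    linarith only [hBl, hBY, hbig]
  have hTY' : (3 : ℤ) < h.depth Y - h.depth T - 1 := by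
    refine lt_of_mul_lt_mul_left ?_ hK.le
    linarith only [hlong, hlv]
  refine ⟨Y, hYU, by omega, hYb, by linarith only [hlong, hK], fun W hWY hTW => ?_⟩
  have hW := h.index_ne_zero_of_depth_ne_zero (W := W) (by omega)
  have hWY' := hmax W (hWY.trans hYU) hTW ((h.depth_le_of_above hWY).trans hYb)
  rw [level_of_index_ne_zero hY, level_of_index_ne_zero hW]
  linarith

theorem common_prefix_length_le (h : IsAdapted X 𝒰) (hμ : X.IsProperColoring μ) {κ : ℕ}
    (hκ : 2 ≤ κ) (hl : IsBranchLevel v v' l) (hvv' : v'.level ≤ v.level) {T : TreeVertex 𝒰 c}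
    (hT : IsMeet T (h.colorMap c v) (h.colorMap c v')) {D : List (Page κ (Letter F))}
    (hD : D <+: h.vertexDiary μ κ c v) (hD' : D <+: h.vertexDiary μ κ c v') :
    ((κ : ℤ) - 1) * (D.length - h.depth T - 1) ≤ 3 * (v.level - l) + 3 * ((κ : ℤ) - 1) := by
  by_contra! hbig
  have hDlen := hD.length_le
  have hDlen' := hD'.length_le
  rw [h.length_vertexDiary] at hDlen hDlen'
  obtain ⟨Y, hYU, hTY, hYD, hlong, hslow⟩ :=
    h.exists_above_level_sub_le hl hT (by omega) hDlen hbig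
  obtain ⟨Y', hYU', hYY'⟩ := h.exists_above_depth_eq (h.colorMap c v') (hYD.trans hDlen')
  have hY := h.index_ne_zero_of_depth_ne_zero (W := Y) (by omega)
  have hY' := h.index_ne_zero_of_depth_ne_zero (W := Y') (by omega)
  obtain ⟨hvY, hYv⟩ := (h.above_colorMap_iff v hY).1 hYU
  obtain ⟨hvY', hYv'⟩ := (h.above_colorMap_iff v' hY').1 hYU'
  have hlY := h.le_index_of_isMeet hl hT hYU (by omega)
  have hlY' := h.le_index_of_isMeet hl.symm hT.symm hYU' (by omega)
  have hread := h.letters_sentence_eq_or μ (h.above_of_depth_le hT.1 hYU (by omega))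
    (h.above_of_depth_le hT.2.1 hYU' (by omega)) hYY'.symm
    (by rw [h.diary_sentence_eq_take hYU hD hYD,
      h.diary_sentence_eq_take hYU' hD' (hYY' ▸ hYD), hYY']) hslow
  have hm : ((((κ - 1) * (h.depth Y - h.depth T - 1) : ℕ)) : ℤ) =
      ((κ : ℤ) - 1) * (h.depth Y - h.depth T - 1) := by
    rw [Nat.cast_mul, Nat.cast_sub (by omega), Nat.sub_sub, Nat.cast_sub (by omega)]
    push_cast
    ring
  obtain ⟨hindex, hd⟩ := h.index_eq_and_dist_le_of_letters hμ hY hY' (hvY v.point_mem_ball)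
    (hvY' v'.point_mem_ball) hl.1.2.2 (by omega) (by omega) (by omega) hread
  have hYl : (Y.index : ℤ) ≤ l := hl.2 ⟨by omega, by omega, hd⟩
  omega

end IsAdapted

namespace IsAdapted

open HypApprox

variable {Z C : Type*} [MetricSpace Z] {r : ℝ} {X : HypApprox Z r} {𝒰 : ℕ → C → Set (Set Z)}
  {F : Type*} {μ : X.Vertex → F} {v v' : X.Vertex} {l : ℤ}

theorem depth_sub_le (h : IsAdapted X 𝒰) (hμ : X.IsProperColoring μ) {κ : ℕ} (hκ : 2 ≤ κ)
    (hl : IsBranchLevel v v' l) (hvv' : v'.level ≤ v.level) {c : C} {T : TreeVertex 𝒰 c}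
    (hT : IsMeet T (h.colorMap c v) (h.colorMap c v')) :
    ((κ : ℤ) - 1) * (h.depth (h.colorMap c v) - h.depth T - h.diaryDist μ κ c v v' - 1) ≤
      3 * (v.level - l) + 3 * ((κ : ℤ) - 1) := by
  obtain ⟨D, hD, hD', hlen⟩ :=
    exists_common_prefix (h.vertexDiary μ κ c v) (h.vertexDiary μ κ c v')
  refine le_trans ?_ (h.common_prefix_length_le hμ hκ hl hvv' hT hD hD')
  have hD'len := hD'.length_le
  rw [h.length_vertexDiary] at hlen
  have hdepth : h.depth (h.colorMap c v) ≤ h.diaryDist μ κ c v v' + D.length := by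
    rw [diaryDist]
    omega
  refine mul_le_mul_of_nonneg_left ?_ (by omega)
  omega

theorem exists_above_colorMap_index_eq (h : IsAdapted X 𝒰) (v : X.Vertex) {j : ℕ} (hj : j ≠ 0)
    (hjv : (j : ℤ) ≤ v.level - 1) :
    ∃ c, ∃ W : TreeVertex 𝒰 c, Above W (h.colorMap c v) ∧ W.index = j := by
  have hk := h.k₀_nonpos
  obtain ⟨w, hw, hvw, -⟩ := exists_walk_lower v ((j : ℤ) + 1) (by omega) (by omega)
  obtain ⟨c, U, hU, hwU⟩ := h.ball_subset j w hw
  let W : TreeVertex 𝒰 c := ⟨(j, U), hU⟩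
  exact ⟨c, W, (h.above_colorMap_iff v (W := W) hj).2 ⟨hvw.trans hwU, hjv⟩, rfl⟩

/-- Every level between `l` and the level of `v` is the level of a vertex below the meet on the
path to `f_c(v)` for some color `c`. -/
theorem level_sub_le_sum_depth_sub [Fintype C] (h : IsAdapted X 𝒰) (hl : IsBranchLevel v v' l)
    (hk₀ : X.k₀ ≤ l) {T : ∀ c, TreeVertex 𝒰 c}
    (hT : ∀ c, IsMeet (T c) (h.colorMap c v) (h.colorMap c v')) :
    v.level - l - 2 ≤ ∑ c, ((h.depth (h.colorMap c v) : ℤ) - h.depth (T c)) := by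
  have hcard : (Finset.Ioc l.toNat (v.level - 1).toNat).card ≤ (Finset.univ.sigma fun c =>
      Finset.Ioc (h.depth (T c)) (h.depth (h.colorMap c v))).card := by
    refine Finset.card_le_card_of_forall_subsingleton (fun j p => ∃ W : TreeVertex 𝒰 p.1,
      Above W (h.colorMap p.1 v) ∧ h.depth W = p.2 ∧ W.index = j) (fun j hj => ?_) ?_
    · rw [Finset.mem_Ioc] at hj
      obtain ⟨c, W, hW, rfl⟩ := h.exists_above_colorMap_index_eq v (j := j) (by omega) (by omega)
      refine ⟨⟨c, h.depth W⟩, Finset.mem_sigma.2 ⟨Finset.mem_univ c, Finset.mem_Ioc.2 ⟨?_, ?_⟩⟩,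
        W, hW, rfl, rfl⟩
      · by_contra! hle
        have hWT := h.above_of_depth_le hW (hT c).1 hle
        have := h.index_le_of_above_of_above hl (by omega) hW (hWT.trans (hT c).2.1)
        omega
      · exact h.depth_le_of_above hW
    · rintro ⟨c, n⟩ - j ⟨-, W, hW, hWn, rfl⟩ j' ⟨-, W', hW', hWn', rfl⟩
      rw [h.depth_injOn _ hW hW' (hWn.trans hWn'.symm)]
  simp only [Finset.card_sigma, Nat.card_Ioc] at hcard
  have hsum : ((∑ c, (h.depth (h.colorMap c v) - h.depth (T c)) : ℕ) : ℤ) =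
      ∑ c, ((h.depth (h.colorMap c v) : ℤ) - h.depth (T c)) := by
    rw [Nat.cast_sum]
    exact Finset.sum_congr rfl fun c _ => Nat.cast_sub (h.depth_le_of_above (hT c).1)
  have hk := h.neg_one_le_k₀
  omega

theorem level_sub_le_sum_diaryDist [Fintype C] (h : IsAdapted X 𝒰) (hμ : X.IsProperColoring μ)
    {κ : ℕ} (hκ : 15 * Fintype.card C + 1 ≤ κ) (hl : IsBranchLevel v v' l) (hk₀ : X.k₀ ≤ l)
    (hvv' : v'.level ≤ v.level) :
    4 * (v.level - l) ≤ 5 * ∑ c, (h.diaryDist μ κ c v v' : ℤ) + 10 + 20 * Fintype.card C := by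
  obtain ⟨c₀, -⟩ := mem_iUnion.1 ((h.isCover 0).cover ▸ mem_univ v.point)
  have hcard : 1 ≤ Fintype.card C := Fintype.card_pos_iff.2 ⟨c₀⟩
  have hlv : l ≤ v.level := hl.1.1
  choose T hT using fun c => h.exists_isMeet (h.colorMap c v) (h.colorMap c v')
  set x : C → ℤ := fun c =>
    h.depth (h.colorMap c v) - h.depth (T c) - h.diaryDist μ κ c v v' - 1 with hx
  have hx_sum : ∑ c, ((h.depth (h.colorMap c v) : ℤ) - h.depth (T c)) =
      ∑ c, x c + ∑ c, (h.diaryDist μ κ c v v' : ℤ) + Fintype.card C := by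
    simp only [hx, Finset.sum_sub_distrib, Finset.sum_const, Finset.card_univ, nsmul_eq_mul,
      mul_one]
    ring
  have hx_mul : ((κ : ℤ) - 1) * ∑ c, x c ≤
      Fintype.card C * (3 * (v.level - l) + 3 * ((κ : ℤ) - 1)) := by
    rw [Finset.mul_sum]
    refine (Finset.sum_le_card_nsmul _ _ _ fun c _ =>
      h.depth_sub_le hμ (by omega) hl hvv' (hT c)).trans_eq ?_
    rw [Finset.card_univ, nsmul_eq_mul]
  have hx_le : 5 * ∑ c, x c ≤ (v.level - l) + 15 * Fintype.card C := by
    have hκ' : (0 : ℤ) ≤ ((κ : ℤ) - 1 - 15 * Fintype.card C) * (v.level - l) :=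
      mul_nonneg (by omega) (by omega)
    refine le_of_mul_le_mul_left ?_ (show (0 : ℤ) < κ - 1 by omega)
    linarith
  have hlevel := h.level_sub_le_sum_depth_sub hl hk₀ hT
  linarith

theorem prodDist_prodDiary_prodMap [Fintype C] (h : IsAdapted X 𝒰) (κ : ℕ) (v v' : X.Vertex) :
    prodDist ((h.prodDiary μ κ ∘ h.prodMap) v) ((h.prodDiary μ κ ∘ h.prodMap) v') =
      ∑ c, (h.diaryDist μ κ c v v' : ℝ) :=
  rfl

theorem dist_le_sum_diaryDist [Fintype C] (h : IsAdapted X 𝒰) (hμ : X.IsProperColoring μ)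
    {κ : ℕ} (hκ : 15 * Fintype.card C + 1 ≤ κ) (v v' : X.Vertex) :
    2 * (X.graph.dist v v' : ℤ) ≤
      5 * ∑ c, (h.diaryDist μ κ c v v' : ℤ) + 16 + 20 * Fintype.card C := by
  wlog hvv' : v'.level ≤ v.level generalizing v v'
  · simpa only [SimpleGraph.dist_comm, h.diaryDist_comm μ κ v v'] using
      this v' v (le_of_not_ge hvv')
  obtain ⟨l, hl, hk₀⟩ := exists_isBranchLevel v v'
  have hdist := dist_le_of_dist_point_le v v' l hk₀ hl.1.1 hl.1.2.1 hl.1.2.2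
  have hlevel := h.level_sub_le_sum_diaryDist hμ hκ hl hk₀ hvv'
  linarith

theorem sum_diaryDist_le [Fintype C] (h : IsAdapted X 𝒰) (κ : ℕ) (v v' : X.Vertex) :
    ∑ c, h.diaryDist μ κ c v v' ≤ Fintype.card C * (4 * X.graph.dist v v') := by
  obtain ⟨p, hp⟩ := (graph_connected X).exists_walk_length_eq_dist v v'
  rw [← hp]
  exact Finset.sum_le_card_nsmul _ _ _ fun c _ => h.diaryDist_le_four_mul_length μ κ p

theorem isQuasiIsometric [Fintype C] (h : IsAdapted X 𝒰) (hμ : X.IsProperColoring μ)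
    {κ : ℕ} (hκ : 15 * Fintype.card C + 1 ≤ κ) :
    IsQuasiIsometric X.vdist prodDist (h.prodDiary μ κ ∘ h.prodMap) := by
  refine ⟨2 / 5, 4 * Fintype.card C + 1, 4 + 4 * Fintype.card C, by norm_num, by positivity,
    by positivity, fun v v' => ?_⟩
  rw [h.prodDist_prodDiary_prodMap, vdist]
  constructor
  · have hlower : 2 * (X.graph.dist v v' : ℝ) ≤
        5 * ∑ c, (h.diaryDist μ κ c v v' : ℝ) + 16 + 20 * Fintype.card C := by
      exact_mod_cast h.dist_le_sum_diaryDist hμ hκ v v'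
    linarith
  · have hupper : ∑ c, (h.diaryDist μ κ c v v' : ℝ) ≤
        Fintype.card C * (4 * (X.graph.dist v v' : ℝ)) := by
      exact_mod_cast h.sum_diaryDist_le κ v v'
    linarith

end IsAdapted

end AliceDiary

theorem theorem8p2_general {Z : Type*} [MetricSpace Z] [Nontrivial Z]
    (hbounded : Bornology.IsBounded (Set.univ : Set Z)) (hdoubling : IsDoubling Z)
    {C : Type*} [Fintype C] (hC : cdim Z < Fintype.card C) :
    (∃ r₀ : ℝ, 0 < r₀ ∧ ∀ r : ℝ, 0 < r → r < r₀ →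
      Nonempty (HypApprox Z r) ∧
      (∃ 𝒰 : ℕ → C → Set (Set Z), ∀ X : HypApprox Z r, IsAdapted X 𝒰) ∧
      (∃ N : ℕ, ∀ X : HypApprox Z r, ∃ μ : X.Vertex → Fin N, X.IsProperColoring μ)) ∧
    (∀ (r : ℝ) (X : HypApprox Z r) (𝒰 : ℕ → C → Set (Set Z)) (h : IsAdapted X 𝒰)
      (F : Type*) [Finite F] (μ : X.Vertex → F), X.IsProperColoring μ →
      ∀ κ : ℕ, 15 * Fintype.card C + 1 ≤ κ →
        X.graph.Connected ∧
        (wordTree (Page κ (Letter F))).IsTree ∧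
        (∀ w, ((wordTree (Page κ (Letter F))).neighborSet w).Finite) ∧
        IsQuasiIsometric X.vdist prodDist (h.prodDiary μ κ ∘ h.prodMap)) := by
  constructor
  · have hD : 0 < Metric.diam (univ : Set Z) :=
      Metric.diam_pos nontrivial_univ hbounded
    obtain ⟨r₀, hr₀, hadapted⟩ := exists_isAdapted_of_cdim_lt hC hbounded hD
    refine ⟨min r₀ (1 / 6), by positivity, fun r hr hrmin => ?_⟩
    obtain ⟨hrr₀, hr6⟩ := lt_min_iff.1 hrmin
    exact ⟨nonempty_hypApprox hr hr6.le hD, hadapted r hr hrr₀,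
      exists_isProperColoring hbounded hdoubling hr⟩
  · intro r X 𝒰 h F _ μ hμ κ hκ
    have := Fintype.ofFinite (Letter F)
    exact ⟨HypApprox.graph_connected X, wordTree_isTree, wordTree_neighborSet_finite,
      h.isQuasiIsometric hμ hκ⟩

theorem theorem8p2 {Z : Type*} [MetricSpace Z] [Nontrivial Z]
    (hbounded : Bornology.IsBounded (Set.univ : Set Z)) (hdoubling : IsDoubling Z)
    (n : ℕ) (hn : cdim Z = n) {C : Type*} [Fintype C] (hC : Fintype.card C = n + 1) :
    -- for every small parameter, all the data of the construction exist
    (∃ r₀ : ℝ, 0 < r₀ ∧ ∀ r : ℝ, 0 < r → r < r₀ →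
      Nonempty (HypApprox Z r) ∧
      (∃ 𝒰 : ℕ → C → Set (Set Z), ∀ X : HypApprox Z r, IsAdapted X 𝒰) ∧
      (∃ N : ℕ, ∀ X : HypApprox Z r, ∃ μ : X.Vertex → Fin N, X.IsProperColoring μ)) ∧
    -- for every choice of the data, the composition is quasi-isometric
    (∀ (r : ℝ) (X : HypApprox Z r) (𝒰 : ℕ → C → Set (Set Z)) (h : IsAdapted X 𝒰)
      (F : Type*) [Finite F] (μ : X.Vertex → F), X.IsProperColoring μ →
      ∀ κ : ℕ, 15 * Fintype.card C + 1 ≤ κ →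
        X.graph.Connected ∧
        (wordTree (Page κ (Letter F))).IsTree ∧
        (∀ w, ((wordTree (Page κ (Letter F))).neighborSet w).Finite) ∧
        IsQuasiIsometric X.vdist prodDist (h.prodDiary μ κ ∘ h.prodMap)) :=
  theorem8p2_general hbounded hdoubling (by rw [hn, hC]; exact_mod_cast Nat.lt_succ_self n)
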